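/- Let $(\mathcal X,\nu)$ be a $\sigma$-finite measure space (write $dx$ for $\nu(dx)$) and let $\phi:\mathcal X^2\to\mathbb R$ be a measurable Mercer kernel, i.e. all finite Gram matrices $(\phi(x^{(i)},x^{(j)}))_{i,j}$ are symmetric positive semidefinite, such that $\int_{\mathcal X}e^{-c\,\phi(x,x)}\,dx<\infty$ for every $c>0$. Put $f(x)=-\phi(x,x)$. For a symmetric array $\theta=(\theta_{st})_{1\le s\ne t\le p}$ let $$\mathbb P(x;\theta)=\exp\Big\{\sum_{s=1}^p f(x_s)+\sum_{s<t}\theta_{st}\,\phi(x_s,x_t)-A(\theta)\Big\},\qquad A(\theta)=\log\int_{\mathcal X^p}\exp\Big\{\sum_{s} f(x_s)+\sum_{s<t}\theta_{st}\,\phi(x_s,x_t)\Big\}dx ,$$ a probability density whenever $A(\theta)<\infty$. Let $\theta^*$ be such that $A(\theta)<\infty$ for all $\theta$ in a neighbourhood of $\theta^*$, that $|\theta^*_{st}|<0.25$ for all $s\ne t$, and that $\mathbb P(\cdot;\theta^*)$ has minimal representation: no $\theta\neq\theta^*$ with $A(\theta)<\infty$ defines the same distribution. Let $X^{(1)},\dots,X^{(n)}$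 be i.i.d. from $\mathbb P(\cdot;\theta^*)$. Fix a node $s$, write $\theta_s=(\theta_{st})_{t\ne s}\in\mathbb R^{p-1}$, let $$\tilde L(\theta_s)=\frac1n\sum_{i=1}^n\Big\{-f(X_s^{(i)})-\sum_{t\ne s}\theta_{st}\phi(X^{(i)}_s,X^{(i)}_t)+\log\int_{\mathcal X}\exp\Big(f(u)+\sum_{t\neq s}\theta_{st}\phi(u,X^{(i)}_t)\Big)du\Big\}$$ be the negative conditional log-likelihood of $X_s$ given the other variables, let $\tilde\gamma_n=\|\nabla\tilde L(\theta^*_s)\|_\infty$, and let $\hat\theta^n_s$ denote a minimizer of $\tilde L(\theta_s)+\lambda_n\|\theta_s\|_1$ over $\theta_s\in\mathbb R^{p-1}$. Then for every $\kappa>0$ there is a constant $C>0$, not depending on $n$ (it may depend on the model $(\nu,\phi,p,\theta^*)$, on $s$ and on $\kappa$), such that for every $c_0\ge2$ there is an $N$ such that for all $n\ge N$, with probability at least $1-p^{-\kappa}$: for every $\lambda_n\in[2\tilde\gamma_n,\,c_0\tilde\gamma_n]$ a minimizer $\hat\theta^n_s$ exists, and every minimizer satisfies $$\|\hat\theta^n_s-\theta^*_s\|\le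 C\,c_0\sqrt{\frac{\|\theta^*_s\|_0\,\ln p}{n}} ,$$ where $\|\cdot\|$ is the Euclidean norm and $\|\cdot\|_0$ counts the nonzero entries. -/

import Mathlib

open MeasureTheory Filter Topology

noncomputable section

namespace SemiEFGM

/-- A Mercer kernel: every finite Gram matrix is (symmetric and) positive semidefinite. -/
def IsMercerKernel {𝒳 : Type*} (φ : 𝒳 → 𝒳 → ℝ) : Prop :=
  ∀ (m : ℕ) (x : Fin m → 𝒳), (Matrix.of fun i j => φ (x i) (x j)).PosSemidef

/-- The exponent `∑ₛ f(xₛ) + ∑_{s<t} θₛₜ φ(xₛ, xₜ)`: all node parameters are `1`, and each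
unordered pair of nodes contributes once (non-edges have `θₛₜ = 0`). -/
def exponent {𝒳 : Type*} {p : ℕ} (f : 𝒳 → ℝ) (φ : 𝒳 → 𝒳 → ℝ) (θ : Fin p → Fin p → ℝ)
    (x : Fin p → 𝒳) : ℝ :=
  ∑ s, f (x s) + ∑ s, ∑ t ∈ Finset.Ioi s, θ s t * φ (x s) (x t)

/-- The condition `A(θ) < ∞`. -/
def Normalizable {𝒳 : Type*} [MeasurableSpace 𝒳] (ν : Measure 𝒳) {p : ℕ} (f : 𝒳 → ℝ)
    (φ : 𝒳 → 𝒳 → ℝ) (θ : Fin p → Fin p → ℝ) : Prop :=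
  Integrable (fun x : Fin p → 𝒳 => Real.exp (exponent f φ θ x)) (Measure.pi fun _ => ν)

/-- The log-partition function `A(θ)`. -/
def logPartition {𝒳 : Type*} [MeasurableSpace 𝒳] (ν : Measure 𝒳) {p : ℕ} (f : 𝒳 → ℝ)
    (φ : 𝒳 → 𝒳 → ℝ) (θ : Fin p → Fin p → ℝ) : ℝ :=
  Real.log (∫ x : Fin p → 𝒳, Real.exp (exponent f φ θ x) ∂(Measure.pi fun _ => ν))

/-- The joint law of `X = (X₁, …, X_p)`, with density `exp(exponent - A(θ))` with respect to
the `p`-fold product of the reference measure `ν` on `𝒳`. -/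
def jointLaw {𝒳 : Type*} [MeasurableSpace 𝒳] (ν : Measure 𝒳) {p : ℕ} (f : 𝒳 → ℝ)
    (φ : 𝒳 → 𝒳 → ℝ) (θ : Fin p → Fin p → ℝ) : Measure (Fin p → 𝒳) :=
  (Measure.pi fun _ => ν).withDensity fun x =>
    ENNReal.ofReal (Real.exp (exponent f φ θ x - logPartition ν f φ θ))

/-- Minimal representation: no other pairwise parameter vector yields the same joint law. -/
def HasMinimalRepresentation {𝒳 : Type*} [MeasurableSpace 𝒳] (ν : Measure 𝒳) {p : ℕ}
    (f : 𝒳 → ℝ) (φ : 𝒳 → 𝒳 → ℝ) (θ : Fin p → Fin p → ℝ) : Prop :=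
  ∀ θ' : Fin p → Fin p → ℝ, Normalizable ν f φ θ' →
    jointLaw ν f φ θ' = jointLaw ν f φ θ → ∀ s t, s < t → θ' s t = θ s t

/-- The space `ℝ^{p-1}` of parameters `θₛ = (θₛₜ)_{t ≠ s}`, with the Euclidean norm. -/
abbrev NodeParam {p : ℕ} (s : Fin p) : Type := EuclideanSpace ℝ {t : Fin p // t ≠ s}

/-- The vector `θₛ = (θₛₜ)_{t ≠ s}` of a parameter array `θ`. -/
def nodeParam {p : ℕ} (θ : Fin p → Fin p → ℝ) (s : Fin p) : NodeParam s :=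
  WithLp.toLp 2 fun t => θ s t

/-- `‖θₛ‖₁`. -/
def l1Norm {p : ℕ} {s : Fin p} (θs : NodeParam s) : ℝ := ∑ t, |θs t|

/-- `‖θₛ‖₀`, the number of nonzero entries. -/
def l0Norm {p : ℕ} {s : Fin p} (θs : NodeParam s) : ℕ := {t | θs t ≠ 0}.ncard

/-- The exponent of the node-conditional law of `Xₛ = u` given the other coordinates of `x`
(the entry `x s` is not used). -/
def nodeExponent {𝒳 : Type*} {p : ℕ} (f : 𝒳 → ℝ) (φ : 𝒳 → 𝒳 → ℝ) {s : Fin p}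
    (θs : NodeParam s) (u : 𝒳) (x : Fin p → 𝒳) : ℝ :=
  f u + ∑ t : {t : Fin p // t ≠ s}, θs t * φ u (x t)

/-- The conditional log-partition function `D(x_{∖s}; θₛ)`. -/
def nodeLogPartition {𝒳 : Type*} [MeasurableSpace 𝒳] (ν : Measure 𝒳) {p : ℕ} (f : 𝒳 → ℝ)
    (φ : 𝒳 → 𝒳 → ℝ) {s : Fin p} (θs : NodeParam s) (x : Fin p → 𝒳) : ℝ :=
  Real.log (∫ u, Real.exp (nodeExponent f φ θs u x) ∂ν)

/-- The conditional density of `Xₛ` given `X_{∖s}`, at the point `x`. -/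
def nodeDensity {𝒳 : Type*} [MeasurableSpace 𝒳] (ν : Measure 𝒳) {p : ℕ} (f : 𝒳 → ℝ)
    (φ : 𝒳 → 𝒳 → ℝ) {s : Fin p} (θs : NodeParam s) (x : Fin p → 𝒳) : ℝ :=
  Real.exp (nodeExponent f φ θs (x s) x - nodeLogPartition ν f φ θs x)

/-- The node-wise negative conditional log-likelihood of the sample `X⁽¹⁾, …, X⁽ⁿ⁾`. -/
def nodeLoss {𝒳 : Type*} [MeasurableSpace 𝒳] (ν : Measure 𝒳) {p n : ℕ} (f : 𝒳 → ℝ)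
    (φ : 𝒳 → 𝒳 → ℝ) {s : Fin p} (X : Fin n → Fin p → 𝒳) (θs : NodeParam s) : ℝ :=
  -(1 / (n : ℝ)) * ∑ i, Real.log (nodeDensity ν f φ θs (X i))

/-- The maximum norm of the gradient of the node-wise loss at `θₛ`. -/
def nodeGradSup {𝒳 : Type*} [MeasurableSpace 𝒳] (ν : Measure 𝒳) {p n : ℕ} (f : 𝒳 → ℝ)
    (φ : 𝒳 → 𝒳 → ℝ) {s : Fin p} (X : Fin n → Fin p → 𝒳) (θs : NodeParam s) : ℝ :=
  ⨆ t, |gradient (nodeLoss ν f φ X) θs t|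

/-- `argmin` of the `ℓ₁`-penalized node-wise loss over all of `ℝ^{p-1}`. -/
def nodeEstimators {𝒳 : Type*} [MeasurableSpace 𝒳] (ν : Measure 𝒳) {p n : ℕ} (f : 𝒳 → ℝ)
    (φ : 𝒳 → 𝒳 → ℝ) (s : Fin p) (X : Fin n → Fin p → 𝒳) (lam : ℝ) : Set (NodeParam s) :=
  {θs | ∀ θs' : NodeParam s,
    nodeLoss ν f φ X θs + lam * l1Norm θs ≤ nodeLoss ν f φ X θs' + lam * l1Norm θs'}

end SemiEFGM

end

namespace SemiEFGM

open scoped RealInnerProductSpace ENNReal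
open ProbabilityTheory

/-! The Bregman remainder of the node loss at the true parameter, in direction `Δ`, is the sample
average of `log E exp⟪Δ, G⟫`, where `G` is the vector of statistics `φ(u, xₜ)` centred under the law
of node `s` given the rest (`nodeLoss_remainder`). By Cauchy-Schwarz for Mercer kernels `‖G‖` grows
at most like `√φ(u,u)`, which the potential `-φ(u,u)` dominates, so `G` has all exponential moments.
Its log-moment generating function is then at least `(1/8) E ⟪Δ, G⟫² exp(-‖G‖)` on the unit ball
(`log_integral_exp_inner_ge`), and Jensen's inequality controls it further out along rays
(`mul_log_integral_exp_inner_le`). If the empirical curvature is bounded below and the gradient at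
the truth is entrywise at most `a`, a deterministic lasso argument (`penalized_minimizers`) gives
existence and an error of order `c₀ a √‖θₛ‖₀`, for all admissible penalties at once.

Both events come from Chebyshev's inequality, since the constant may depend on `p` and `κ`: take `a`
of order `√(log p / n)`. The score is centred and square integrable because `A` is finite near the
true parameter; the weight `exp(-‖G‖)` makes the curvature entries bounded.

The population curvature must be positive definite (`integral_curvature_pos`). If it vanished at `Δ
≠ 0`, then `⟪Δ, feature⟫` would not depend on `u`; varying one coordinate `xₜ` with `Δ t ≠ 0` would
force `φ(u,y) = a(u) + d(y)` almost everywhere. A Mercer kernel of this form is almost everywhere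
constant (`IsMercerKernel.ae_const_of_ae_add`), and a constant kernel contradicts minimality
(`not_ae_const`). -/

theorem quarter_sq_mul_exp_neg_abs_le (y : ℝ) :
    y ^ 2 / 4 * Real.exp (-|y|) ≤ Real.exp y - 1 - y := by
  have he : Real.exp (-|y|) ≤ 1 := Real.exp_le_one_iff.2 (by simp)
  have he0 := Real.exp_pos (-|y|)
  rcases le_or_gt 0 y with hy | hy
  · have := Real.quadratic_le_exp_of_nonneg hy
    nlinarith [sq_nonneg y]
  · rcases le_or_gt (-2) y with h2 | h2
    -- Squaring the tangent bound at `y / 2`, nonnegative on this range, produces exactly `1 + y +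
    -- y² / 4`.
    · have h1 : 1 + y / 2 ≤ Real.exp (y / 2) := by linarith [Real.add_one_le_exp (y / 2)]
      have h3 : Real.exp y = Real.exp (y / 2) ^ 2 := by
        rw [← Real.exp_nat_mul]; congr 1; push_cast; ring
      have h4 : (1 + y / 2) ^ 2 ≤ Real.exp (y / 2) ^ 2 :=
        pow_le_pow_left₀ (by linarith) h1 2
      nlinarith [sq_nonneg y]
    · have h5 := Real.quadratic_le_exp_of_nonneg (x := -y) (by linarith)
      rw [abs_of_neg hy, neg_neg] at *
      have h6 : Real.exp y * Real.exp (-y) = 1 := by rw [← Real.exp_add]; simp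
      have h7 : y ^ 2 / 2 * Real.exp y ≤ 1 := by
        nlinarith [Real.exp_pos y]
      nlinarith [Real.exp_pos y]

theorem exp_sub_one_sub_le (y : ℝ) : Real.exp y - 1 - y ≤ y ^ 2 * Real.exp |y| := by
  have h1 : Real.exp y - 1 ≤ y * Real.exp y := by
    have h2 := Real.add_one_le_exp (-y)
    have h6 : Real.exp (-y) * Real.exp y = 1 := by rw [← Real.exp_add]; simp
    nlinarith [Real.exp_pos y]
  rcases le_or_gt 0 y with hy | hy
  · rw [abs_of_nonneg hy]
    nlinarith
  · have h3 : 1 ≤ Real.exp |y| := Real.one_le_exp (abs_nonneg y)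
    have h4 := Real.add_one_le_exp y
    nlinarith [sq_nonneg y]

theorem sq_mul_exp_neg_le_two {r : ℝ} (hr : 0 ≤ r) : r ^ 2 * Real.exp (-r) ≤ 2 := by
  have h5 := Real.quadratic_le_exp_of_nonneg hr
  have h6 : Real.exp (-r) * Real.exp r = 1 := by rw [← Real.exp_add]; simp
  nlinarith [Real.exp_pos (-r)]

/-! ### Log-moment generating functions of centred vectors -/

section LogMGF

variable {Ω E : Type*} [MeasurableSpace Ω] [NormedAddCommGroup E] {P : Measure Ω} {G : Ω → E}

/-- All exponential moments of the norm of `G` are finite under `P`. -/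
def HasExpMoments (P : Measure Ω) (G : Ω → E) : Prop :=
  AEStronglyMeasurable G P ∧ ∀ a : ℝ, Integrable (fun ω => Real.exp (a * ‖G ω‖)) P

theorem HasExpMoments.integrable_of_norm_le (hG : HasExpMoments P G) {F : Type*}
    [NormedAddCommGroup F] {g : Ω → F} (hg : AEStronglyMeasurable g P) (a c : ℝ)
    (h : ∀ ω, ‖g ω‖ ≤ c * Real.exp (a * ‖G ω‖)) : Integrable g P :=
  ((hG.2 a).const_mul c).mono' hg (Eventually.of_forall h)

theorem HasExpMoments.integrable (hG : HasExpMoments P G) : Integrable G P :=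
  hG.integrable_of_norm_le hG.1 1 1 fun ω => by
    have := Real.add_one_le_exp ‖G ω‖
    simp only [one_mul]; linarith

theorem HasExpMoments.sub_const [IsFiniteMeasure P] (hG : HasExpMoments P G) (m : E) :
    HasExpMoments P (fun ω => G ω - m) := by
  have hm : AEStronglyMeasurable (fun ω => G ω - m) P := hG.1.sub aestronglyMeasurable_const
  refine ⟨hm, fun a => ?_⟩
  refine hG.integrable_of_norm_le ?_ |a| (Real.exp (|a| * ‖m‖)) fun ω => ?_
  · exact Real.continuous_exp.comp_aestronglyMeasurable (hm.norm.const_mul a)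
  · rw [Real.norm_eq_abs, Real.abs_exp, ← Real.exp_add]
    refine Real.exp_le_exp.2 ?_
    calc a * ‖G ω - m‖ ≤ |a| * ‖G ω - m‖ := by gcongr; exact le_abs_self a
      _ ≤ |a| * (‖G ω‖ + ‖m‖) := by gcongr; exact norm_sub_le _ _
      _ = _ := by ring

variable [InnerProductSpace ℝ E]

theorem HasExpMoments.integrable_exp_inner (hG : HasExpMoments P G) (Δ : E) :
    Integrable (fun ω => Real.exp ⟪Δ, G ω⟫) P :=
  hG.integrable_of_norm_le
    (Real.continuous_exp.comp_aestronglyMeasurable (aestronglyMeasurable_const.inner hG.1)) ‖Δ‖ 1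
    fun ω => by
      rw [Real.norm_eq_abs, Real.abs_exp, one_mul]
      exact Real.exp_le_exp.2 (real_inner_le_norm _ _)

theorem sq_le_two_mul_exp {r : ℝ} (hr : 0 ≤ r) : r ^ 2 ≤ 2 * Real.exp r := by
  linarith [Real.quadratic_le_exp_of_nonneg hr]

variable [IsProbabilityMeasure P]

theorem log_integral_exp_inner_sub [CompleteSpace E] (hG : HasExpMoments P G) (Δ : E) :
    Real.log (∫ ω, Real.exp ⟪Δ, G ω - ∫ ω', G ω' ∂P⟫ ∂P)
      = Real.log (∫ ω, Real.exp ⟪Δ, G ω⟫ ∂P) - ⟪Δ, ∫ ω', G ω' ∂P⟫ := by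
  have h : ∀ ω, Real.exp ⟪Δ, G ω - ∫ ω', G ω' ∂P⟫
      = Real.exp ⟪Δ, G ω⟫ * Real.exp (-⟪Δ, ∫ ω', G ω' ∂P⟫) := fun ω => by
    rw [inner_sub_right, sub_eq_add_neg, Real.exp_add]
  simp_rw [h]
  rw [integral_mul_const, Real.log_mul (integral_exp_pos (hG.integrable_exp_inner Δ)).ne'
    (Real.exp_pos _).ne', Real.log_exp, sub_eq_add_neg]

theorem integral_exp_inner_sub_one [CompleteSpace E]
    (hG : HasExpMoments P G) (hG0 : ∫ ω, G ω ∂P = 0) (Δ : E) :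
    Integrable (fun ω => Real.exp ⟪Δ, G ω⟫ - 1 - ⟪Δ, G ω⟫) P ∧
    ∫ ω, (Real.exp ⟪Δ, G ω⟫ - 1 - ⟪Δ, G ω⟫) ∂P = ∫ ω, Real.exp ⟪Δ, G ω⟫ ∂P - 1 := by
  have h1 := hG.integrable_exp_inner Δ
  have h2 : Integrable (fun ω => ⟪Δ, G ω⟫) P := hG.integrable.const_inner Δ
  have h3 : Integrable (fun ω => Real.exp ⟪Δ, G ω⟫ - 1) P := h1.sub (integrable_const 1)
  refine ⟨h3.sub h2, ?_⟩
  rw [integral_sub h3 h2, integral_sub h1 (integrable_const 1),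
    integral_inner hG.integrable, hG0]
  simp

theorem integrable_inner_sq_mul_exp_neg_norm (hG : HasExpMoments P G) (Δ : E) :
    Integrable (fun ω => ⟪Δ, G ω⟫ ^ 2 * Real.exp (-‖G ω‖)) P := by
  refine (integrable_const (‖Δ‖ ^ 2 * 2)).mono' ?_ (Eventually.of_forall fun ω => ?_)
  · exact ((aestronglyMeasurable_const.inner hG.1).pow 2).mul
      (Real.continuous_exp.comp_aestronglyMeasurable hG.1.norm.neg)
  · rw [Real.norm_eq_abs, abs_of_nonneg (by positivity)]
    calc ⟪Δ, G ω⟫ ^ 2 * Real.exp (-‖G ω‖)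
        ≤ (‖Δ‖ * ‖G ω‖) ^ 2 * Real.exp (-‖G ω‖) := by
          gcongr ?_ * _
          rw [← sq_abs]
          exact pow_le_pow_left₀ (abs_nonneg _) (abs_real_inner_le_norm _ _) 2
      _ = ‖Δ‖ ^ 2 * (‖G ω‖ ^ 2 * Real.exp (-‖G ω‖)) := by ring
      _ ≤ _ := by gcongr; exact sq_mul_exp_neg_le_two (norm_nonneg _)

/-- Centring removes the linear term of the exponential. The weight `exp(-‖G‖)` keeps the quadratic
term `w` at most `1/2` for every `G`, so `log (1 + w) ≥ w / (1 + w) ≥ w / 2` loses only a constant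
factor. -/
theorem log_integral_exp_inner_ge [CompleteSpace E] (hG : HasExpMoments P G)
    (hG0 : ∫ ω, G ω ∂P = 0) {Δ : E}
    (hΔ : ‖Δ‖ ≤ 1) :
    (1 / 8) * ∫ ω, ⟪Δ, G ω⟫ ^ 2 * Real.exp (-‖G ω‖) ∂P
      ≤ Real.log (∫ ω, Real.exp ⟪Δ, G ω⟫ ∂P) := by
  obtain ⟨hi, he⟩ := integral_exp_inner_sub_one hG hG0 Δ
  have hq := integrable_inner_sq_mul_exp_neg_norm hG Δ
  set w := (1 / 4) * ∫ ω, ⟪Δ, G ω⟫ ^ 2 * Real.exp (-‖G ω‖) ∂P with hw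
  have hin : ∀ ω, |⟪Δ, G ω⟫| ≤ ‖G ω‖ := fun ω =>
    (abs_real_inner_le_norm _ _).trans (mul_le_of_le_one_left (norm_nonneg _) hΔ)
  have h1 : w ≤ ∫ ω, Real.exp ⟪Δ, G ω⟫ ∂P - 1 := by
    rw [← he, hw, ← integral_const_mul]
    refine integral_mono (hq.const_mul _) hi fun ω => ?_
    refine le_trans ?_ (quarter_sq_mul_exp_neg_abs_le _)
    have : Real.exp (-‖G ω‖) ≤ Real.exp (-|⟪Δ, G ω⟫|) :=
      Real.exp_le_exp.2 (neg_le_neg (hin ω))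
    nlinarith [sq_nonneg ⟪Δ, G ω⟫]
  have h2 : w ≤ 1 / 2 := by
    have : ∫ ω, ⟪Δ, G ω⟫ ^ 2 * Real.exp (-‖G ω‖) ∂P ≤ ∫ ω, (2 : ℝ) ∂P := by
      refine integral_mono hq (integrable_const _) fun ω => ?_
      refine le_trans ?_ (sq_mul_exp_neg_le_two (norm_nonneg (G ω)))
      dsimp only
      gcongr ?_ * _
      rw [← sq_abs]
      exact pow_le_pow_left₀ (abs_nonneg _) (hin ω) 2
    simp at this
    linarith
  have h0 : 0 ≤ w := by
    rw [hw]
    exact mul_nonneg (by norm_num) (integral_nonneg fun ω => by positivity)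
  have h3 : Real.log (1 + w) ≤ Real.log (∫ ω, Real.exp ⟪Δ, G ω⟫ ∂P) :=
    Real.log_le_log (by linarith) (by linarith)
  have h4 := Real.one_sub_inv_le_log_of_pos (x := 1 + w) (by linarith)
  have h5 : w / 2 ≤ 1 - (1 + w)⁻¹ := by
    have : 1 - (1 + w)⁻¹ = w / (1 + w) := by field_simp; ring
    rw [this]
    exact div_le_div_of_nonneg_left h0 (by linarith) (by linarith)
  have h6 : (1 / 8) * ∫ ω, ⟪Δ, G ω⟫ ^ 2 * Real.exp (-‖G ω‖) ∂P = w / 2 := by rw [hw]; ring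
  linarith

/-- Needed only for differentiability: a remainder of order `‖Δ‖²` identifies the gradient. -/
theorem log_integral_exp_inner_le [CompleteSpace E] (hG : HasExpMoments P G)
    (hG0 : ∫ ω, G ω ∂P = 0) {Δ : E}
    (hΔ : ‖Δ‖ ≤ 1) :
    Real.log (∫ ω, Real.exp ⟪Δ, G ω⟫ ∂P)
      ≤ (∫ ω, ‖G ω‖ ^ 2 * Real.exp ‖G ω‖ ∂P) * ‖Δ‖ ^ 2 := by
  obtain ⟨hi, he⟩ := integral_exp_inner_sub_one hG hG0 Δ
  have hI : Integrable (fun ω => ‖G ω‖ ^ 2 * Real.exp ‖G ω‖) P := by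
    refine hG.integrable_of_norm_le ?_ 2 2 fun ω => ?_
    · exact (hG.1.norm.pow 2).mul (Real.continuous_exp.comp_aestronglyMeasurable hG.1.norm)
    · rw [Real.norm_eq_abs, abs_of_nonneg (by positivity), two_mul ‖G ω‖, Real.exp_add, ← mul_assoc]
      gcongr
      exact sq_le_two_mul_exp (norm_nonneg _)
  refine (Real.log_le_sub_one_of_pos (integral_exp_pos (hG.integrable_exp_inner Δ))).trans ?_
  rw [← he, ← integral_mul_const]
  refine integral_mono hi (hI.mul_const _) fun ω => (exp_sub_one_sub_le _).trans ?_
  have hin := abs_real_inner_le_norm Δ (G ω)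
  calc ⟪Δ, G ω⟫ ^ 2 * Real.exp |⟪Δ, G ω⟫|
      ≤ (‖Δ‖ * ‖G ω‖) ^ 2 * Real.exp ‖G ω‖ := by
        rw [← sq_abs]
        gcongr
        exact hin.trans (mul_le_of_le_one_left (norm_nonneg _) hΔ)
    _ = _ := by ring

/-- Jensen's inequality for the convex power `x ↦ x ^ τ`. It carries the lower bound from the unit
sphere outwards. -/
theorem mul_log_integral_exp_inner_le (hG : HasExpMoments P G) (Δ : E) {τ : ℝ} (hτ : 1 ≤ τ) :
    τ * Real.log (∫ ω, Real.exp ⟪Δ, G ω⟫ ∂P) ≤ Real.log (∫ ω, Real.exp ⟪τ • Δ, G ω⟫ ∂P) := by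
  have hpos := integral_exp_pos (hG.integrable_exp_inner Δ)
  have hpow : ∀ ω, Real.exp ⟪Δ, G ω⟫ ^ τ = Real.exp ⟪τ • Δ, G ω⟫ := fun ω => by
    rw [← Real.exp_mul, real_inner_smul_left, mul_comm]
  rw [← Real.log_rpow hpos]
  refine Real.log_le_log (Real.rpow_pos_of_pos hpos _) ?_
  have := (convexOn_rpow hτ).map_integral_le (μ := P) (f := fun ω => Real.exp ⟪Δ, G ω⟫)
    (Real.continuous_rpow_const (by linarith)).continuousOn isClosed_Ici
    (Eventually.of_forall fun ω => (Real.exp_pos _).le) (hG.integrable_exp_inner Δ)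
    (by simpa only [Function.comp_def, hpow] using hG.integrable_exp_inner (τ • Δ))
  simpa only [hpow] using this

end LogMGF

/-! ### Deterministic analysis of the lasso -/

section Lasso

variable {ι : Type*} [Fintype ι]

theorem hasGradientAt_of_abs_sub_le {E : Type*} [NormedAddCommGroup E] [InnerProductSpace ℝ E]
    [CompleteSpace E] {F : E → ℝ} {g θ : E} {C : ℝ}
    (h : ∀ Δ : E, ‖Δ‖ ≤ 1 → |F (θ + Δ) - F θ - ⟪g, Δ⟫| ≤ C * ‖Δ‖ ^ 2) :
    HasGradientAt F g θ := by
  have hO : (fun x => F x - F θ - ⟪g, x - θ⟫) =O[𝓝 θ] fun x => ‖x - θ‖ ^ 2 := by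
    refine Asymptotics.IsBigO.of_bound C ?_
    filter_upwards [Metric.closedBall_mem_nhds θ one_pos] with x hx
    have := h (x - θ) (by simpa [dist_eq_norm] using hx)
    simpa using this
  have h1 := hO.hasFDerivAt (𝕜 := ℝ) (by norm_num)
  have h2 : HasFDerivAt (fun x => F θ + ⟪g, x - θ⟫) (InnerProductSpace.toDual ℝ E g) θ := by
    have h3 := (InnerProductSpace.toDual ℝ E g).hasFDerivAt (x := θ)
    have h4 := h3.const_add (F θ - ⟪g, θ⟫)
    refine h4.congr_of_eventuallyEq (Eventually.of_forall fun x => ?_)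
    simp [inner_sub_right]
    ring
  rw [hasGradientAt_iff_hasFDerivAt]
  have h5 := h1.add h2
  rw [zero_add] at h5
  refine h5.congr_of_eventuallyEq (Eventually.of_forall fun x => ?_)
  simp

theorem sum_abs_support_le (θ Δ : EuclideanSpace ℝ ι) :
    ∑ t with θ t ≠ 0, |Δ t| ≤ √({t | θ t ≠ 0}.ncard : ℝ) * ‖Δ‖ := by
  classical
  have hc : ({t | θ t ≠ 0}.ncard : ℝ) = ((Finset.univ.filter fun t => θ t ≠ 0).card : ℝ) := by
    rw [← Set.ncard_coe_finset]; simp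
  rw [hc, EuclideanSpace.norm_eq, ← Real.sqrt_mul (Nat.cast_nonneg _)]
  refine Real.le_sqrt_of_sq_le ?_
  refine sq_sum_le_card_mul_sum_sq.trans ?_
  gcongr
  refine (Finset.sum_le_univ_sum_of_nonneg fun t => sq_nonneg _).trans_eq ?_
  simp

/-- The change of the linear part and of the penalty of a lasso objective is controlled by the
support of the true parameter. -/
theorem penalized_linear_part_le {θ g : EuclideanSpace ℝ ι} {γ lam : ℝ} (hg : ∀ t, |g t| ≤ γ)
    (hlam0 : 0 ≤ lam) (hlam : 2 * γ ≤ lam) (Δ : EuclideanSpace ℝ ι) :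
    -⟪g, Δ⟫ + lam * ∑ t, |θ t| - lam * ∑ t, |(θ + Δ) t|
      ≤ 3 / 2 * lam * √({t | θ t ≠ 0}.ncard : ℝ) * ‖Δ‖ := by
  classical
  have hs := sum_abs_support_le θ Δ
  have hin : ⟪g, Δ⟫ = ∑ t, g t * Δ t := by
    simp [PiLp.inner_apply, mul_comm]
  have h1 : -⟪g, Δ⟫ + lam * ∑ t, |θ t| - lam * ∑ t, |(θ + Δ) t|
      ≤ ∑ t, if θ t ≠ 0 then 3 / 2 * lam * |Δ t| else 0 := by
    rw [hin, Finset.mul_sum, Finset.mul_sum, ← Finset.sum_neg_distrib, ← Finset.sum_add_distrib,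
      ← Finset.sum_sub_distrib]
    refine Finset.sum_le_sum fun t _ => ?_
    have hgt : -(g t * Δ t) ≤ lam / 2 * |Δ t| := by
      refine (neg_le_abs _).trans ?_
      rw [abs_mul]
      exact mul_le_mul_of_nonneg_right (by linarith [hg t]) (abs_nonneg _)
    -- On the support the gradient contributes `lam / 2` and the penalty `lam`. Off it the penalty
    -- grows by `lam * |Δ t|`, which absorbs the gradient term.
    split_ifs with h0
    · have h2 : |θ t| - |θ t + Δ t| ≤ |Δ t| := by
        have := abs_sub_abs_le_abs_sub (θ t) (θ t + Δ t)
        simpa using this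
      have h3 := mul_le_mul_of_nonneg_left h2 hlam0
      simp only [PiLp.add_apply]
      linarith
    · have h0' : θ t = 0 := not_not.1 h0
      have := mul_nonneg hlam0 (abs_nonneg (Δ t))
      simp only [PiLp.add_apply, h0', zero_add, abs_zero, mul_zero, add_zero]
      linarith
  refine h1.trans ?_
  rw [← Finset.sum_filter, ← Finset.mul_sum, mul_assoc (3 / 2 * lam)]
  exact mul_le_mul_of_nonneg_left hs (by positivity)

/-- Existence and error bound for minimizers of an `ℓ₁`-penalized loss with a locally quadratic
and star-shaped Bregman remainder. -/
theorem penalized_minimizers {L : EuclideanSpace ℝ ι → ℝ} (hL : Continuous L)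
    {θ g : EuclideanSpace ℝ ι} {γ lam m : ℝ} (hg : ∀ t, |g t| ≤ γ) (hlam0 : 0 ≤ lam)
    (hlam : 2 * γ ≤ lam) (hm : 0 < m)
    (hquad : ∀ Δ : EuclideanSpace ℝ ι, ‖Δ‖ ≤ 1 → m * ‖Δ‖ ^ 2 ≤ L (θ + Δ) - L θ - ⟪g, Δ⟫)
    (hscale : ∀ (Δ : EuclideanSpace ℝ ι) (τ : ℝ), 1 ≤ τ →
      τ * (L (θ + Δ) - L θ - ⟪g, Δ⟫) ≤ L (θ + τ • Δ) - L θ - ⟪g, τ • Δ⟫)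
    (hsmall : 3 / 2 * lam * √({t | θ t ≠ 0}.ncard : ℝ) < m) :
    (∃ θ₁, ∀ θ₂, L θ₁ + lam * ∑ t, |θ₁ t| ≤ L θ₂ + lam * ∑ t, |θ₂ t|) ∧
    ∀ θ₁, (∀ θ₂, L θ₁ + lam * ∑ t, |θ₁ t| ≤ L θ₂ + lam * ∑ t, |θ₂ t|) →
      ‖θ₁ - θ‖ ≤ 3 / 2 * lam * √({t | θ t ≠ 0}.ncard : ℝ) / m := by
  set b := 3 / 2 * lam * √({t | θ t ≠ 0}.ncard : ℝ) with hb
  set F : EuclideanSpace ℝ ι → ℝ := fun θ₁ => L θ₁ + lam * ∑ t, |θ₁ t| with hF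
  have hbase : ∀ Δ, L (θ + Δ) - L θ - ⟪g, Δ⟫ - b * ‖Δ‖ ≤ F (θ + Δ) - F θ := fun Δ => by
    have := penalized_linear_part_le (θ := θ) hg hlam0 hlam Δ
    rw [← hb] at this
    simp only [hF]
    linarith
  -- The remainder is at least `m` at the normalized direction, hence at least `m * ‖Δ‖ > b * ‖Δ‖`
  -- at `Δ`. This yields existence by compactness and localizes every minimizer.
  have hfar : ∀ Δ, 1 ≤ ‖Δ‖ → F θ < F (θ + Δ) := fun Δ hΔ => by
    have hpos : 0 < ‖Δ‖ := by linarith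
    have hn : ‖‖Δ‖⁻¹ • Δ‖ = 1 := by
      rw [norm_smul, norm_inv, norm_norm, inv_mul_cancel₀ hpos.ne']
    have h1 := hscale (‖Δ‖⁻¹ • Δ) ‖Δ‖ hΔ
    rw [smul_inv_smul₀ hpos.ne'] at h1
    have h2 := hquad (‖Δ‖⁻¹ • Δ) hn.le
    rw [hn] at h2
    have h3 := mul_le_mul_of_nonneg_left h2 hpos.le
    have h4 := hbase Δ
    nlinarith
  have hFc : Continuous F := hL.add (continuous_const.mul (by fun_prop))
  refine ⟨?_, fun θ₁ h₁ => ?_⟩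
  · obtain ⟨θ₁, hθ₁, hmin⟩ := (isCompact_closedBall θ (1 : ℝ)).exists_isMinOn
      ⟨θ, Metric.mem_closedBall_self zero_le_one⟩ hFc.continuousOn
    refine ⟨θ₁, fun θ₂ => ?_⟩
    by_cases h2 : θ₂ ∈ Metric.closedBall θ (1 : ℝ)
    · exact hmin h2
    · have h3 : F θ < F θ₂ := by
        have := hfar (θ₂ - θ) (by
          rw [Metric.mem_closedBall, not_le, dist_eq_norm] at h2
          exact h2.le)
        rwa [add_sub_cancel] at this
      exact (hmin (Metric.mem_closedBall_self zero_le_one)).trans h3.le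
  · have hle : F θ₁ ≤ F θ := h₁ θ
    have hlt : ‖θ₁ - θ‖ < 1 := by
      by_contra! h
      have := hfar _ h
      rw [add_sub_cancel] at this
      linarith
    have h4 := hbase (θ₁ - θ)
    have h5 := hquad _ hlt.le
    rw [add_sub_cancel] at h4 h5
    rw [le_div_iff₀ hm]
    rcases (norm_nonneg (θ₁ - θ)).eq_or_lt with h0 | h0
    · rw [← h0, zero_mul]; positivity
    · refine le_of_mul_le_mul_right ?_ h0
      nlinarith

end Lasso

/-! ### Chebyshev bounds and integrated positivity of Mercer kernels -/

section Sampling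

theorem sampleMean_deviation {Ω : Type*} [MeasurableSpace Ω] {J : Measure Ω}
    [IsProbabilityMeasure J] {g : Ω → ℝ} (hg : MemLp g 2 J) {n : ℕ} (hn : 0 < n) {ε : ℝ}
    (hε : 0 < ε) :
    (Measure.pi fun _ : Fin n => J) {X | ε ≤ |1 / (n : ℝ) * ∑ i, g (X i) - ∫ x, g x ∂J|}
      ≤ ENNReal.ofReal (ProbabilityTheory.variance g J / (n * ε ^ 2)) := by
  have hn' : (0 : ℝ) < n := by exact_mod_cast hn
  set Y : (Fin n → Ω) → ℝ := ∑ i, fun X => g (X i) with hY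
  have hmp : ∀ i : Fin n, MeasurePreserving (Function.eval i) (Measure.pi fun _ : Fin n => J) J :=
    fun i => measurePreserving_eval _ i
  have hi : ∀ i : Fin n, MemLp (fun X : Fin n → Ω => g (X i)) 2 (Measure.pi fun _ => J) :=
    fun i => hg.comp_measurePreserving (hmp i)
  have hYL : MemLp Y 2 (Measure.pi fun _ : Fin n => J) := memLp_finsetSum' _ fun i _ => hi i
  have hmean : ∫ X, Y X ∂(Measure.pi fun _ : Fin n => J) = n * ∫ x, g x ∂J := by
    simp only [hY, Finset.sum_apply]
    rw [integral_finsetSum _ fun i _ => (hi i).integrable (by norm_num)]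
    have : ∀ i : Fin n, ∫ X : Fin n → Ω, g (X i) ∂(Measure.pi fun _ => J) = ∫ x, g x ∂J :=
      fun i => by
        have h := integral_map (φ := Function.eval i) (μ := Measure.pi fun _ : Fin n => J)
          (hmp i).measurable.aemeasurable (f := g) (by rw [(hmp i).map_eq]; exact hg.1)
        rw [(hmp i).map_eq] at h
        exact h.symm
    simp [this]
  have hvar : ProbabilityTheory.variance Y (Measure.pi fun _ : Fin n => J)
      = n * ProbabilityTheory.variance g J := by
    rw [hY, ProbabilityTheory.variance_sum_pi fun _ => hg]
    simp
  have h := ProbabilityTheory.meas_ge_le_variance_div_sq hYL (c := n * ε) (by positivity)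
  rw [hmean, hvar] at h
  refine (measure_mono fun X hX => ?_).trans (h.trans_eq ?_)
  · simp only [Set.mem_ofPred_eq] at hX ⊢
    have : Y X - n * ∫ x, g x ∂J = n * (1 / (n : ℝ) * ∑ i, g (X i) - ∫ x, g x ∂J) := by
      simp only [hY, Finset.sum_apply]
      field_simp
    rw [this, abs_mul, abs_of_pos hn']
    gcongr
  · congr 1
    field_simp

theorem map_eval_pair {Ω : Type*} [MeasurableSpace Ω] (μ : Measure Ω) [IsProbabilityMeasure μ]
    {m : ℕ} {i j : Fin m} (hij : i ≠ j) :
    (Measure.pi fun _ : Fin m => μ).map (fun ω => (ω i, ω j)) = μ.prod μ := by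
  have h := ProbabilityTheory.iIndepFun_pi (μ := fun _ : Fin m => μ) (X := fun _ ω => ω)
    fun _ => aemeasurable_id
  have h2 := (ProbabilityTheory.indepFun_iff_map_prod_eq_prod_map_map
    (measurable_pi_apply i).aemeasurable (measurable_pi_apply j).aemeasurable).1 (h.indepFun hij)
  rw [(measurePreserving_eval (fun _ : Fin m => μ) i).map_eq,
    (measurePreserving_eval (fun _ : Fin m => μ) j).map_eq] at h2
  exact h2

/-- Average the Gram form over `m + 1` independent points: the diagonal contributes `(m + 1) D` and
the other pairs `(m + 1) m I`. As `m` grows the diagonal becomes negligible, so `I` cannot be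
negative. -/
theorem IsMercerKernel.integral_mul_mul_nonneg {Ω : Type*} [MeasurableSpace Ω] {μ : Measure Ω}
    [IsProbabilityMeasure μ] {φ : Ω → Ω → ℝ} (hφ : IsMercerKernel φ) {g : Ω → ℝ}
    (hd : Integrable (fun u => φ u u * g u * g u) μ)
    (ho : Integrable (fun z : Ω × Ω => φ z.1 z.2 * g z.1 * g z.2) (μ.prod μ)) :
    0 ≤ ∫ z, φ z.1 z.2 * g z.1 * g z.2 ∂(μ.prod μ) := by
  set I := ∫ z, φ z.1 z.2 * g z.1 * g z.2 ∂(μ.prod μ)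
  set D := ∫ u, φ u u * g u * g u ∂μ
  have key : ∀ m : ℕ, 0 ≤ ((m : ℝ) + 1) * (D + m * I) := fun m => by
    let π := Measure.pi fun _ : Fin (m + 1) => μ
    have hint : ∀ i j : Fin (m + 1), Integrable (fun ω => φ (ω i) (ω j) * g (ω i) * g (ω j)) π ∧
        ∫ ω, φ (ω i) (ω j) * g (ω i) * g (ω j) ∂π = if i = j then D else I := fun i j => by
      split_ifs with hij
      · subst hij
        have hmp := measurePreserving_eval (fun _ : Fin (m + 1) => μ) i
        rw [← hmp.map_eq] at hd
        refine ⟨hd.comp_measurable hmp.measurable, ?_⟩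
        have := integral_map hmp.measurable.aemeasurable hd.1
        rw [hmp.map_eq] at this
        exact this.symm
      · have hm := map_eval_pair μ hij
        have hme : Measurable fun ω : Fin (m + 1) → Ω => (ω i, ω j) := by fun_prop
        rw [← hm] at ho
        refine ⟨ho.comp_measurable hme, ?_⟩
        have := integral_map hme.aemeasurable ho.1
        rw [hm] at this
        exact this.symm
    have hpos : 0 ≤ ∫ ω, ∑ i, ∑ j, φ (ω i) (ω j) * g (ω i) * g (ω j) ∂π := by
      refine integral_nonneg fun ω => ?_
      have := (hφ (m + 1) ω).dotProduct_mulVec_nonneg (fun i => g (ω i))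
      simp only [dotProduct, Matrix.mulVec, Matrix.of_apply, Finset.mul_sum, Pi.star_apply,
        star_trivial] at this
      refine this.trans_eq (Finset.sum_congr rfl fun i _ => Finset.sum_congr rfl fun j _ => ?_)
      ring
    rw [integral_finsetSum _ fun i _ => integrable_finsetSum _ fun j _ => (hint i j).1] at hpos
    simp_rw [integral_finsetSum _ fun j _ => (hint _ j).1, (hint _ _).2] at hpos
    have hrow : ∀ i : Fin (m + 1), (∑ j, if i = j then D else I) = D + m * I := fun i => by
      have : ∀ j, (if i = j then D else I) = (if i = j then D - I else 0) + I := fun j => by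
        split_ifs <;> ring
      simp_rw [this]
      rw [Finset.sum_add_distrib, Finset.sum_ite_eq]
      simp
      ring
    simp_rw [hrow] at hpos
    simpa [mul_add] using hpos
  by_contra! hI
  obtain ⟨m, hm⟩ := exists_nat_gt (D / -I)
  rw [div_lt_iff₀ (by linarith)] at hm
  have := key m
  have h1 : (0 : ℝ) < m + 1 := by positivity
  nlinarith

end Sampling

/-! ### Cauchy-Schwarz for Mercer kernels -/

section Mercer

variable {𝒳 : Type*} {φ : 𝒳 → 𝒳 → ℝ}

theorem IsMercerKernel.symm (hφ : IsMercerKernel φ) (u v : 𝒳) : φ u v = φ v u := by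
  have h := (hφ 2 ![u, v]).isHermitian.apply 0 1
  simpa using h.symm

theorem IsMercerKernel.diag_nonneg (hφ : IsMercerKernel φ) (u : 𝒳) : 0 ≤ φ u u := by
  have h := (hφ 1 ![u]).diag_nonneg (i := 0)
  simpa using h

theorem IsMercerKernel.abs_le (hφ : IsMercerKernel φ) (u v : 𝒳) :
    |φ u v| ≤ √(φ u u) * √(φ v v) := by
  have h := (hφ 2 ![u, v]).det_nonneg
  rw [Matrix.det_fin_two] at h
  simp only [Matrix.of_apply, Matrix.cons_val_zero, Matrix.cons_val_one] at h
  rw [← Real.sqrt_mul (hφ.diag_nonneg u)]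
  refine Real.abs_le_sqrt ?_
  rw [hφ.symm v u] at h
  nlinarith

end Mercer

/-! ### The conditional law of a node and the node-wise loss -/

/-- The vector `(φ(u, xₜ))_{t ≠ s}` of sufficient statistics of the conditional law of node `s`. -/
noncomputable def feature {𝒳 : Type*} {p : ℕ} (φ : 𝒳 → 𝒳 → ℝ) (s : Fin p) (x : Fin p → 𝒳)
    (u : 𝒳) : NodeParam s := WithLp.toLp 2 fun t => φ u (x t)

/-- The law of `Xₛ` given the other coordinates. -/
noncomputable def condLaw {𝒳 : Type*} [MeasurableSpace 𝒳] (ν : Measure 𝒳) {p : ℕ} (f : 𝒳 → ℝ)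
    (φ : 𝒳 → 𝒳 → ℝ) {s : Fin p} (θs : NodeParam s) (x : Fin p → 𝒳) : Measure 𝒳 :=
  ν.tilted fun u => nodeExponent f φ θs u x

/-- The conditional mean of the sufficient statistics. -/
noncomputable def condMean {𝒳 : Type*} [MeasurableSpace 𝒳] (ν : Measure 𝒳) {p : ℕ} (f : 𝒳 → ℝ)
    (φ : 𝒳 → 𝒳 → ℝ) {s : Fin p} (θs : NodeParam s) (x : Fin p → 𝒳) : NodeParam s :=
  ∫ u, feature φ s x u ∂(condLaw ν f φ θs x)

/-- The sufficient statistics, centred at their conditional mean. -/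
noncomputable def centred {𝒳 : Type*} [MeasurableSpace 𝒳] (ν : Measure 𝒳) {p : ℕ} (f : 𝒳 → ℝ)
    (φ : 𝒳 → 𝒳 → ℝ) {s : Fin p} (θs : NodeParam s) (x : Fin p → 𝒳) (u : 𝒳) : NodeParam s :=
  feature φ s x u - condMean ν f φ θs x

/-- A lower bound for the curvature of the conditional log-partition function in direction `Δ`. -/
noncomputable def curvature {𝒳 : Type*} [MeasurableSpace 𝒳] (ν : Measure 𝒳) {p : ℕ} (f : 𝒳 → ℝ)
    (φ : 𝒳 → 𝒳 → ℝ) {s : Fin p} (θs : NodeParam s) (x : Fin p → 𝒳) (Δ : NodeParam s) : ℝ :=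
  ∫ u, ⟪Δ, centred ν f φ θs x u⟫ ^ 2 * Real.exp (-‖centred ν f φ θs x u‖) ∂(condLaw ν f φ θs x)

/-- The gradient of the node-wise loss. -/
noncomputable def nodeGrad {𝒳 : Type*} [MeasurableSpace 𝒳] (ν : Measure 𝒳) {p n : ℕ} (f : 𝒳 → ℝ)
    (φ : 𝒳 → 𝒳 → ℝ) {s : Fin p} (X : Fin n → Fin p → 𝒳) (θs : NodeParam s) : NodeParam s :=
  -(1 / (n : ℝ)) • ∑ i, centred ν f φ θs (X i) (X i s)

section Feature

variable {𝒳 : Type*} {φ : 𝒳 → 𝒳 → ℝ} {f : 𝒳 → ℝ} {p : ℕ} {s : Fin p}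

theorem nodeExponent_eq (θs : NodeParam s) (u : 𝒳) (x : Fin p → 𝒳) :
    nodeExponent f φ θs u x = f u + ⟪θs, feature φ s x u⟫ := by
  simp [nodeExponent, feature, PiLp.inner_apply, mul_comm]

theorem norm_feature_le (hφ : IsMercerKernel φ) (x : Fin p → 𝒳) (u : 𝒳) :
    ‖feature φ s x u‖ ≤ √(∑ t : {t : Fin p // t ≠ s}, φ (x t) (x t)) * √(φ u u) := by
  rw [EuclideanSpace.norm_eq, ← Real.sqrt_mul (Finset.sum_nonneg fun t _ => hφ.diag_nonneg _),
    Finset.sum_mul]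
  refine Real.sqrt_le_sqrt (Finset.sum_le_sum fun t _ => ?_)
  have h := hφ.abs_le u (x t)
  calc ‖feature φ s x u t‖ ^ 2 = |φ u (x t)| ^ 2 := by simp [feature]
    _ ≤ (√(φ u u) * √(φ (x t) (x t))) ^ 2 := by gcongr
    _ = φ (x t) (x t) * φ u u := by
      rw [mul_pow, Real.sq_sqrt (hφ.diag_nonneg _), Real.sq_sqrt (hφ.diag_nonneg _), mul_comm]

end Feature

/-- The standing assumptions on the reference measure, the potential and the kernel. -/
structure KernelModel {𝒳 : Type*} [MeasurableSpace 𝒳] (ν : Measure 𝒳) (f : 𝒳 → ℝ)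
    (φ : 𝒳 → 𝒳 → ℝ) : Prop where
  measurable_kernel : Measurable (Function.uncurry φ)
  mercer : IsMercerKernel φ
  integrable_exp : ∀ c : ℝ, 0 < c → Integrable (fun x => Real.exp (-c * φ x x)) ν
  potential_eq : ∀ x, f x = -φ x x

section Conditional

variable {𝒳 : Type*} [MeasurableSpace 𝒳] {ν : Measure 𝒳} {φ : 𝒳 → 𝒳 → ℝ} {f : 𝒳 → ℝ} {p : ℕ}
  {s : Fin p}

theorem measurable_feature (hm : Measurable (Function.uncurry φ)) :
    Measurable fun z : (Fin p → 𝒳) × 𝒳 => feature φ s z.1 z.2 := by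
  refine (WithLp.measurable_toLp 2 _).comp (measurable_pi_iff.2 fun t => ?_)
  have : Measurable fun z : (Fin p → 𝒳) × 𝒳 => (z.2, z.1 t) := by fun_prop
  exact hm.comp this

theorem measurable_nodeExponent (hm : Measurable (Function.uncurry φ)) (hf : Measurable f)
    (θs : NodeParam s) :
    Measurable fun z : (Fin p → 𝒳) × 𝒳 => nodeExponent f φ θs z.2 z.1 := by
  simp_rw [nodeExponent_eq]
  exact (hf.comp measurable_snd).add ((measurable_feature hm).const_inner)

namespace KernelModel

theorem measurable_potential (M : KernelModel ν f φ) : Measurable f := by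
  rw [show f = fun x => -φ x x from funext M.potential_eq]
  have : Measurable fun x : 𝒳 => (x, x) := by fun_prop
  exact (M.measurable_kernel.comp this).neg

/-- Completing the square gives `-r² + a r ≤ a² / 2 - r² / 2` with `r = √(φ u u)`; half of the
potential pays for the linear term and the other half is integrable. -/
theorem integrable_of_abs_le_exp (M : KernelModel ν f φ) {w : 𝒳 → ℝ} (hw : Measurable w)
    (a b : ℝ) (h : ∀ u, |w u| ≤ b * Real.exp (f u + a * √(φ u u))) : Integrable w ν := by
  have hb : ∀ u, |w u| ≤ |b| * Real.exp (a ^ 2 / 2) * Real.exp (-(1 / 2) * φ u u) := fun u => by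
    refine (h u).trans ?_
    rw [mul_assoc, ← Real.exp_add]
    have h1 : f u + a * √(φ u u) ≤ a ^ 2 / 2 + -(1 / 2) * φ u u := by
      have := Real.sq_sqrt (M.mercer.diag_nonneg u)
      rw [M.potential_eq]
      nlinarith [sq_nonneg (a - √(φ u u))]
    exact mul_le_mul (le_abs_self b) (Real.exp_le_exp.2 h1) (Real.exp_pos _).le (abs_nonneg _)
  exact ((M.integrable_exp (1 / 2) (by norm_num)).const_mul _).mono' hw.aestronglyMeasurable
    (Eventually.of_forall hb)

theorem measurable_nodeExponent_left (M : KernelModel ν f φ) (θs : NodeParam s) (x : Fin p → 𝒳) :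
    Measurable fun u => nodeExponent f φ θs u x :=
  (measurable_nodeExponent M.measurable_kernel M.measurable_potential θs).comp
    measurable_prodMk_left

theorem nodeExponent_add_le (M : KernelModel ν f φ) (θs : NodeParam s) (x : Fin p → 𝒳) (c : ℝ)
    (u : 𝒳) : nodeExponent f φ θs u x + c * ‖feature φ s x u‖ ≤
      f u + (‖θs‖ + |c|) * √(∑ t : {t : Fin p // t ≠ s}, φ (x t) (x t)) * √(φ u u) := by
  have h1 := norm_feature_le (s := s) M.mercer x u
  have h2 := real_inner_le_norm θs (feature φ s x u)
  have h3 : c * ‖feature φ s x u‖ ≤ |c| * ‖feature φ s x u‖ := by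
    gcongr; exact le_abs_self c
  have h4 := mul_le_mul_of_nonneg_left h1 (add_nonneg (norm_nonneg θs) (abs_nonneg c))
  rw [nodeExponent_eq]
  linarith

theorem integrable_exp_nodeExponent (M : KernelModel ν f φ) (θs : NodeParam s) (x : Fin p → 𝒳) :
    Integrable (fun u => Real.exp (nodeExponent f φ θs u x)) ν := by
  refine M.integrable_of_abs_le_exp (Real.measurable_exp.comp (M.measurable_nodeExponent_left θs x))
    ((‖θs‖ + |0|) * √(∑ t : {t : Fin p // t ≠ s}, φ (x t) (x t))) 1 fun u => ?_
  rw [Real.abs_exp, one_mul]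
  refine Real.exp_le_exp.2 ?_
  simpa using M.nodeExponent_add_le θs x 0 u

theorem hasExpMoments_feature (M : KernelModel ν f φ) (θs : NodeParam s) (x : Fin p → 𝒳) :
    HasExpMoments (condLaw ν f φ θs x) (feature φ s x) := by
  have hF : Measurable (feature φ s x) :=
    (measurable_feature M.measurable_kernel).comp measurable_prodMk_left
  refine ⟨hF.aestronglyMeasurable, fun a => ?_⟩
  rw [condLaw, integrable_tilted_iff (M.integrable_exp_nodeExponent θs x)]
  have he := M.measurable_nodeExponent_left θs x
  simp_rw [smul_eq_mul, ← Real.exp_add]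
  refine M.integrable_of_abs_le_exp (by fun_prop)
    ((‖θs‖ + |a|) * √(∑ t : {t : Fin p // t ≠ s}, φ (x t) (x t))) 1 fun u => ?_
  rw [Real.abs_exp, one_mul]
  exact Real.exp_le_exp.2 (M.nodeExponent_add_le θs x a u)

variable [NeZero ν]

theorem isProbabilityMeasure_condLaw (M : KernelModel ν f φ) (θs : NodeParam s)
    (x : Fin p → 𝒳) : IsProbabilityMeasure (condLaw ν f φ θs x) :=
  isProbabilityMeasure_tilted (M.integrable_exp_nodeExponent θs x)

theorem hasExpMoments_centred (M : KernelModel ν f φ) (θs : NodeParam s) (x : Fin p → 𝒳) :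
    HasExpMoments (condLaw ν f φ θs x) (centred ν f φ θs x) :=
  have := M.isProbabilityMeasure_condLaw θs x
  (M.hasExpMoments_feature θs x).sub_const _

theorem integral_centred (M : KernelModel ν f φ) (θs : NodeParam s) (x : Fin p → 𝒳) :
    ∫ u, centred ν f φ θs x u ∂(condLaw ν f φ θs x) = 0 := by
  have := M.isProbabilityMeasure_condLaw θs x
  simp only [centred]
  rw [integral_sub (M.hasExpMoments_feature θs x).integrable (integrable_const _)]
  simp [condMean]

/-- The ratio of the two partition functions is the moment generating function of the statistics
under the exponentially tilted law; centring splits off the linear term. -/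
theorem nodeLogPartition_add (M : KernelModel ν f φ) (θs Δ : NodeParam s) (x : Fin p → 𝒳) :
    nodeLogPartition ν f φ (θs + Δ) x = nodeLogPartition ν f φ θs x
      + ⟪Δ, condMean ν f φ θs x⟫
      + Real.log (∫ u, Real.exp ⟪Δ, centred ν f φ θs x u⟫ ∂(condLaw ν f φ θs x)) := by
  have := M.isProbabilityMeasure_condLaw θs x
  have h1 := log_integral_exp_inner_sub (M.hasExpMoments_feature θs x) Δ
  have h2 : ∫ u, Real.exp ⟪Δ, feature φ s x u⟫ ∂(condLaw ν f φ θs x)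
      = (∫ u, Real.exp (nodeExponent f φ (θs + Δ) u x) ∂ν)
        / ∫ u, Real.exp (nodeExponent f φ θs u x) ∂ν := by
    rw [condLaw, integral_exp_tilted]
    congr 2
    ext u
    simp only [Pi.add_apply, nodeExponent_eq, inner_add_left]
    ring_nf
  rw [h2, Real.log_div (integral_exp_pos (M.integrable_exp_nodeExponent _ x)).ne'
    (integral_exp_pos (M.integrable_exp_nodeExponent _ x)).ne'] at h1
  simp only [centred, condMean, nodeLogPartition] at h1 ⊢
  linarith

/-- The Bregman remainder of the loss is an average of centred conditional log-moment generating
functions. -/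
theorem nodeLoss_remainder (M : KernelModel ν f φ) {n : ℕ} (X : Fin n → Fin p → 𝒳)
    (θs Δ : NodeParam s) :
    nodeLoss ν f φ X (θs + Δ) - nodeLoss ν f φ X θs - ⟪nodeGrad ν f φ X θs, Δ⟫
      = 1 / (n : ℝ) * ∑ i, Real.log
        (∫ u, Real.exp ⟪Δ, centred ν f φ θs (X i) u⟫ ∂(condLaw ν f φ θs (X i))) := by
  simp only [nodeLoss, nodeDensity, Real.log_exp, nodeGrad, real_inner_smul_left, sum_inner]
  have h : ∀ i, Real.log
        (∫ u, Real.exp ⟪Δ, centred ν f φ θs (X i) u⟫ ∂(condLaw ν f φ θs (X i)))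
      = (nodeExponent f φ θs (X i s) (X i) - nodeLogPartition ν f φ θs (X i))
        - (nodeExponent f φ (θs + Δ) (X i s) (X i) - nodeLogPartition ν f φ (θs + Δ) (X i))
        + ⟪centred ν f φ θs (X i) (X i s), Δ⟫ := fun i => by
    rw [M.nodeLogPartition_add θs Δ (X i), nodeExponent_eq, nodeExponent_eq, inner_add_left,
      real_inner_comm Δ (centred ν f φ θs (X i) (X i s)), centred, inner_sub_right]
    ring
  simp_rw [h, Finset.sum_add_distrib, Finset.sum_sub_distrib]
  ring

/-- The remainder lies between `0` and a multiple of `‖Δ‖²` on the unit ball, so no differentiation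
under the integral is needed. -/
theorem hasGradientAt_nodeLoss (M : KernelModel ν f φ) {n : ℕ} (X : Fin n → Fin p → 𝒳)
    (θs : NodeParam s) :
    HasGradientAt (nodeLoss ν f φ X) (nodeGrad ν f φ X θs) θs := by
  refine hasGradientAt_of_abs_sub_le (C := 1 / (n : ℝ) * ∑ i, ∫ u,
    ‖centred ν f φ θs (X i) u‖ ^ 2 * Real.exp ‖centred ν f φ θs (X i) u‖
      ∂(condLaw ν f φ θs (X i))) fun Δ hΔ => ?_
  have hP := fun i => M.isProbabilityMeasure_condLaw θs (X i)
  rw [M.nodeLoss_remainder, abs_of_nonneg]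
  · rw [mul_assoc, Finset.sum_mul]
    gcongr with i
    exact log_integral_exp_inner_le (M.hasExpMoments_centred θs _) (M.integral_centred θs _) hΔ
  · refine mul_nonneg (by positivity) (Finset.sum_nonneg fun i _ => ?_)
    refine le_trans ?_ (log_integral_exp_inner_ge (M.hasExpMoments_centred θs _)
      (M.integral_centred θs _) hΔ)
    exact mul_nonneg (by norm_num) (integral_nonneg fun u => by positivity)

theorem continuous_nodeLoss (M : KernelModel ν f φ) {n : ℕ} (X : Fin n → Fin p → 𝒳) :
    Continuous (nodeLoss ν f φ X : NodeParam s → ℝ) :=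
  continuous_iff_continuousAt.2 fun θs => (M.hasGradientAt_nodeLoss X θs).continuousAt

theorem nodeGradSup_eq (M : KernelModel ν f φ) {n : ℕ} (X : Fin n → Fin p → 𝒳)
    (θs : NodeParam s) :
    nodeGradSup ν f φ X θs = ⨆ t, |nodeGrad ν f φ X θs t| := by
  rw [nodeGradSup, (M.hasGradientAt_nodeLoss X θs).gradient]

/-- The estimation error bound on the event that the empirical curvature is bounded below and the
gradient at the true parameter is small. -/
theorem nodeEstimators_error (M : KernelModel ν f φ) {n : ℕ} (X : Fin n → Fin p → 𝒳)
    (θs : NodeParam s) {m a c₀ : ℝ} (hm : 0 < m)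
    (hcurv : ∀ Δ : NodeParam s, m * ‖Δ‖ ^ 2 ≤ 1 / (n : ℝ) * ∑ i, curvature ν f φ θs (X i) Δ)
    (ha : ∀ t, |nodeGrad ν f φ X θs t| ≤ a) (ha0 : 0 ≤ a) (hc₀ : 0 ≤ c₀)
    (hsmall : 12 * (c₀ * a) * √(l0Norm θs : ℝ) < m) {lam : ℝ}
    (hl : 2 * nodeGradSup ν f φ X θs ≤ lam) (hu : lam ≤ c₀ * nodeGradSup ν f φ X θs) :
    (nodeEstimators ν f φ s X lam).Nonempty ∧
      ∀ θhat ∈ nodeEstimators ν f φ s X lam,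
        ‖θhat - θs‖ ≤ 12 * (c₀ * a) * √(l0Norm θs : ℝ) / m := by
  have hP := fun i => M.isProbabilityMeasure_condLaw θs (X i)
  rw [M.nodeGradSup_eq] at hl hu
  have hγ0 : 0 ≤ ⨆ t, |nodeGrad ν f φ X θs t| := Real.iSup_nonneg fun t => abs_nonneg _
  have hγ : ∀ t, |nodeGrad ν f φ X θs t| ≤ ⨆ t, |nodeGrad ν f φ X θs t| := fun t =>
    le_ciSup (f := fun t => |nodeGrad ν f φ X θs t|) (Set.finite_range _).bddAbove t
  have hγa : ⨆ t, |nodeGrad ν f φ X θs t| ≤ a := Real.iSup_le ha ha0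
  have hlam0 : 0 ≤ lam := by linarith
  have hlama : lam ≤ c₀ * a := hu.trans (by gcongr)
  -- Here `12 = 8 * (3 / 2)`: the loss has modulus `m / 8` when the curvature has lower bound `m`.
  have hle : 3 / 2 * lam * √(l0Norm θs : ℝ) ≤ 12 * (c₀ * a) * √(l0Norm θs : ℝ) / 8 := by
    rw [mul_div_right_comm]
    gcongr
    linarith
  have key := penalized_minimizers (M.continuous_nodeLoss X) (θ := θs)
    (g := nodeGrad ν f φ X θs) (m := m / 8) hγ hlam0 hl (by positivity) (fun Δ hΔ => ?_)
    (fun Δ τ hτ => ?_) (hle.trans_lt (by linarith))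
  · refine ⟨key.1, fun θhat hθ => (key.2 θhat hθ).trans ?_⟩
    rw [div_le_div_iff₀ (by positivity) hm]
    have := mul_le_mul_of_nonneg_right hle hm.le
    simp only [l0Norm] at this ⊢
    linarith
  · rw [M.nodeLoss_remainder]
    have h1 : 1 / (n : ℝ) * ∑ i, (1 / 8) * curvature ν f φ θs (X i) Δ ≤ 1 / (n : ℝ) * ∑ i, Real.log
        (∫ u, Real.exp ⟪Δ, centred ν f φ θs (X i) u⟫ ∂(condLaw ν f φ θs (X i))) := by
      gcongr with i
      exact log_integral_exp_inner_ge (M.hasExpMoments_centred θs _) (M.integral_centred θs _) hΔ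
    rw [← Finset.mul_sum] at h1
    linarith [hcurv Δ]
  · rw [M.nodeLoss_remainder, M.nodeLoss_remainder, mul_left_comm, Finset.mul_sum]
    gcongr with i
    exact mul_log_integral_exp_inner_le (M.hasExpMoments_centred θs _) Δ hτ

end KernelModel

end Conditional

/-! ### Separating one node from the joint exponent -/

section Exponent

variable {𝒳 : Type*} {φ : 𝒳 → 𝒳 → ℝ} {f : 𝒳 → ℝ} {p : ℕ} {θ : Fin p → Fin p → ℝ}

/-- The part of the exponent that does not involve node `s`. -/
noncomputable def restExponent (f : 𝒳 → ℝ) (φ : 𝒳 → 𝒳 → ℝ) (θ : Fin p → Fin p → ℝ) (s : Fin p)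
    (x : Fin p → 𝒳) : ℝ :=
  ∑ a, (if a = s then 0 else f (x a)) +
    ∑ a, ∑ b ∈ Finset.Ioi a, if a = s ∨ b = s then 0 else θ a b * φ (x a) (x b)

/-- Node `s` is the first index of its pairs with larger nodes and the second index of those with
smaller ones; symmetry merges the two families. -/
theorem sum_pairs_eq_add (F : Fin p → Fin p → ℝ) (hF : ∀ a b, F a b = F b a) (s : Fin p) :
    ∑ a, ∑ b ∈ Finset.Ioi a, F a b =
      ∑ t : {t : Fin p // t ≠ s}, F s t
        + ∑ a, ∑ b ∈ Finset.Ioi a, if a = s ∨ b = s then 0 else F a b := by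
  have h1 : ∀ a, ∑ b ∈ Finset.Ioi a, F a b
      = (∑ b ∈ Finset.Ioi a, if a = s ∨ b = s then F a b else 0)
      + ∑ b ∈ Finset.Ioi a, if a = s ∨ b = s then 0 else F a b := fun a => by
    rw [← Finset.sum_add_distrib]
    exact Finset.sum_congr rfl fun b _ => by split_ifs <;> simp
  simp_rw [h1]
  rw [Finset.sum_add_distrib]
  congr 1
  have h2 : ∀ a b : Fin p, a < b → (if a = s ∨ b = s then F a b else 0)
      = (if a = s then F s b else 0) + if b = s then F s a else 0 := fun a b hab => by
    by_cases ha : a = s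
    · subst ha
      simp [hab.ne']
    · by_cases hb : b = s
      · subst hb; simp [ha, hF a b]
      · simp [ha, hb]
  have h3 : ∀ a, (∑ b ∈ Finset.Ioi a, if a = s ∨ b = s then F a b else 0)
      = (if a = s then ∑ b ∈ Finset.Ioi s, F s b else 0) + if a < s then F s a else 0 := fun a => by
    rw [Finset.sum_congr rfl fun b hb => h2 a b (Finset.mem_Ioi.1 hb), Finset.sum_add_distrib]
    congr 1
    · split_ifs with h
      · subst h; rfl
      · simp
    · simp
  simp_rw [h3]
  rw [Finset.sum_add_distrib, Finset.sum_ite_eq' , if_pos (Finset.mem_univ _)]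
  rw [← Finset.sum_subtype (Finset.univ.filter fun t => t ≠ s) (by simp) (fun t => F s t)]
  rw [← Finset.sum_filter, Finset.sum_filter, Finset.sum_filter,
    show Finset.Ioi s = Finset.univ.filter fun b => s < b by ext; simp, Finset.sum_filter,
    ← Finset.sum_add_distrib]
  refine Finset.sum_congr rfl fun t _ => ?_
  rcases lt_trichotomy s t with h | h | h
  · simp [h, h.ne', h.not_gt]
  · subst h; simp
  · simp [h, h.ne, h.not_gt]

theorem exponent_eq_add (hφ : IsMercerKernel φ) (hθ : ∀ s t, θ s t = θ t s) (s : Fin p)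
    (x : Fin p → 𝒳) :
    exponent f φ θ x = nodeExponent f φ (nodeParam θ s) (x s) x + restExponent f φ θ s x := by
  rw [exponent, sum_pairs_eq_add (fun a b => θ a b * φ (x a) (x b))
    (fun a b => by rw [hθ, hφ.symm]) s, nodeExponent, restExponent]
  have : ∑ a, f (x a) = f (x s) + ∑ a, if a = s then 0 else f (x a) := by
    rw [← Finset.add_sum_erase Finset.univ (fun a => f (x a)) (Finset.mem_univ s),
      ← Finset.add_sum_erase Finset.univ (fun a => if a = s then 0 else f (x a))
        (Finset.mem_univ s)]
    simp only [if_true, zero_add]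
    congr 1
    exact Finset.sum_congr rfl fun a ha => by rw [if_neg (Finset.ne_of_mem_erase ha)]
  rw [this]
  simp only [nodeParam]
  ring

theorem restExponent_update (s : Fin p) (x : Fin p → 𝒳) (u : 𝒳) :
    restExponent f φ θ s (Function.update x s u) = restExponent f φ θ s x := by
  unfold restExponent
  congr 1
  · refine Finset.sum_congr rfl fun a _ => ?_
    split_ifs with h
    · rfl
    · rw [Function.update_of_ne h]
  · refine Finset.sum_congr rfl fun a _ => Finset.sum_congr rfl fun b _ => ?_
    split_ifs with h
    · rfl
    · push Not at h
      rw [Function.update_of_ne h.1, Function.update_of_ne h.2]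

theorem feature_update (s : Fin p) (x : Fin p → 𝒳) (v u : 𝒳) :
    feature φ s (Function.update x s v) u = feature φ s x u := by
  ext t
  simp [feature, Function.update_of_ne t.2]

theorem nodeExponent_update {s : Fin p} (θs : NodeParam s) (x : Fin p → 𝒳) (v u : 𝒳) :
    nodeExponent f φ θs u (Function.update x s v) = nodeExponent f φ θs u x := by
  rw [nodeExponent_eq, nodeExponent_eq, feature_update]

end Exponent

/-! ### Invariance of the joint law under resampling a node -/

section Joint

variable {𝒳 : Type*} [MeasurableSpace 𝒳] {ν : Measure 𝒳} {φ : 𝒳 → 𝒳 → ℝ} {f : 𝒳 → ℝ} {p : ℕ}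
  {θ : Fin p → Fin p → ℝ}

theorem neZero_pi [SigmaFinite ν] [NeZero ν] : NeZero (Measure.pi fun _ : Fin p => ν) := by
  refine ⟨fun h => ?_⟩
  have h1 : (Measure.pi fun _ : Fin p => ν) Set.univ = 0 := by rw [h]; simp
  rw [Measure.pi_univ, Finset.prod_eq_zero_iff] at h1
  obtain ⟨_, _, h2⟩ := h1
  exact NeZero.ne ν (Measure.measure_univ_eq_zero.1 h2)

theorem jointLaw_eq_tilted [SigmaFinite ν] [NeZero ν] (hN : Normalizable ν f φ θ) :
    jointLaw ν f φ θ = (Measure.pi fun _ => ν).tilted (exponent f φ θ) := by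
  have := neZero_pi (ν := ν) (p := p)
  simp only [jointLaw, Measure.tilted, logPartition, Real.exp_sub,
    Real.exp_log (integral_exp_pos hN)]

theorem isProbabilityMeasure_jointLaw [SigmaFinite ν] [NeZero ν] (hN : Normalizable ν f φ θ) :
    IsProbabilityMeasure (jointLaw ν f φ θ) := by
  have := neZero_pi (ν := ν) (p := p)
  rw [jointLaw_eq_tilted hN]
  exact isProbabilityMeasure_tilted hN

namespace KernelModel

theorem measurable_exponent (M : KernelModel ν f φ) (θ : Fin p → Fin p → ℝ) :
    Measurable (exponent f φ θ) := by
  have h := M.measurable_potential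
  unfold exponent
  refine Measurable.add (by fun_prop) (Finset.measurable_fun_sum _ fun a _ =>
    Finset.measurable_fun_sum _ fun b _ => Measurable.const_mul ?_ _)
  have h2 : Measurable fun x : Fin p → 𝒳 => (x a, x b) := by fun_prop
  exact M.measurable_kernel.comp h2

variable [SigmaFinite ν] {s : Fin p}

theorem measurable_integral_exp_nodeExponent (M : KernelModel ν f φ) (θs : NodeParam s) :
    Measurable fun x => ∫ u, Real.exp (nodeExponent f φ θs u x) ∂ν :=
  (((Real.measurable_exp.comp (measurable_nodeExponent M.measurable_kernel M.measurable_potential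
    θs)).stronglyMeasurable).integral_prod_right').measurable

theorem measurable_condDensity (M : KernelModel ν f φ) (θs : NodeParam s) :
    Measurable fun z : (Fin p → 𝒳) × 𝒳 => ENNReal.ofReal
      (Real.exp (nodeExponent f φ θs z.2 z.1) / ∫ u, Real.exp (nodeExponent f φ θs u z.1) ∂ν) :=
  ENNReal.measurable_ofReal.comp
    ((Real.measurable_exp.comp (measurable_nodeExponent M.measurable_kernel M.measurable_potential
      θs)).div ((M.measurable_integral_exp_nodeExponent θs).comp measurable_fst))

/-- The conditional law of `Xₛ` as a Markov kernel. -/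
noncomputable def condKernel (M : KernelModel ν f φ) (θs : NodeParam s) :
    Kernel (Fin p → 𝒳) 𝒳 where
  toFun := condLaw ν f φ θs
  measurable' := Measure.measurable_of_measurable_coe _ fun A hA => by
    simp_rw [condLaw, tilted_apply' _ _ hA, ← lintegral_indicator hA]
    refine Measurable.lintegral_prod_right' (f := fun z : (Fin p → 𝒳) × 𝒳 =>
      A.indicator (fun u => ENNReal.ofReal (Real.exp (nodeExponent f φ θs u z.1) /
        ∫ u, Real.exp (nodeExponent f φ θs u z.1) ∂ν)) z.2) ?_
    exact (M.measurable_condDensity θs).indicator (measurable_snd hA)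

@[simp]
theorem condKernel_apply (M : KernelModel ν f φ) (θs : NodeParam s) (x : Fin p → 𝒳) :
    M.condKernel θs x = condLaw ν f φ θs x := rfl

instance isMarkovKernel_condKernel [NeZero ν] (M : KernelModel ν f φ) (θs : NodeParam s) :
    IsMarkovKernel (M.condKernel θs) :=
  ⟨fun x => M.isProbabilityMeasure_condLaw θs x⟩

/-- Resampling coordinate `s` from its conditional law leaves the joint law invariant. -/
theorem map_update_compProd [NeZero ν] (M : KernelModel ν f φ) (hN : Normalizable ν f φ θ)
    (hθ : ∀ s t, θ s t = θ t s) (s : Fin p) :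
    (jointLaw ν f φ θ ⊗ₘ M.condKernel (nodeParam θ s)).map
      (fun z => Function.update z.1 s z.2) = jointLaw ν f φ θ := by
  have := isProbabilityMeasure_jointLaw hN
  have hT : Measurable fun z : (Fin p → 𝒳) × 𝒳 => Function.update z.1 s z.2 := by
    fun_prop
  refine Measure.ext fun A hA => ?_
  set Z := fun x => ∫ u, Real.exp (nodeExponent f φ (nodeParam θ s) u x) ∂ν
  have hZ : ∀ x, 0 < Z x := fun x => integral_exp_pos (M.integrable_exp_nodeExponent _ x)
  have hme := M.measurable_exponent θ
  have hmA : Measurable (A.indicator (1 : (Fin p → 𝒳) → ℝ≥0∞)) := measurable_one.indicator hA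
  have hcond : ∀ x, (M.condKernel (nodeParam θ s) x) (Prod.mk x ⁻¹'
      ((fun z : (Fin p → 𝒳) × 𝒳 => Function.update z.1 s z.2) ⁻¹' A))
      = ∫⁻ u, ENNReal.ofReal (Real.exp (nodeExponent f φ (nodeParam θ s) u x) / Z x)
        * A.indicator 1 (Function.update x s u) ∂ν := fun x => by
    rw [← lintegral_indicator_one (measurable_prodMk_left (hT hA)), condKernel_apply, condLaw,
      lintegral_tilted]
    rfl
  rw [Measure.map_apply hT hA, Measure.compProd_apply (hT hA), ← lintegral_indicator_one hA]
  simp_rw [hcond]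
  rw [jointLaw_eq_tilted hN, lintegral_tilted, lintegral_tilted]
  have hc0 : 0 ≤ ∫ x, Real.exp (exponent f φ θ x) ∂(Measure.pi fun _ => ν) :=
    integral_nonneg fun x => (Real.exp_pos _).le
  generalize (∫ x, Real.exp (exponent f φ θ x) ∂(Measure.pi fun _ => ν)) = c at hc0 ⊢
  -- It suffices to compare after integrating out coordinate `s`. The rest of the density is then
  -- constant, and the integral of the node factor cancels the conditional normalizer.
  refine lintegral_eq_of_lmarginal_eq {s} ?_ ?_ ?_
  · refine Measurable.mul (by fun_prop) (Measurable.lintegral_prod_right' (f := fun z =>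
      ENNReal.ofReal (Real.exp (nodeExponent f φ (nodeParam θ s) z.2 z.1) / Z z.1)
        * A.indicator 1 (Function.update z.1 s z.2)) ?_)
    exact (M.measurable_condDensity _).mul (hmA.comp hT)
  · exact Measurable.mul (by fun_prop) hmA
  · rw [lmarginal_singleton, lmarginal_singleton]
    ext x
    have hexp : ∀ v, Real.exp (exponent f φ θ (Function.update x s v)) / c
        = Real.exp (restExponent f φ θ s x) / c
          * Real.exp (nodeExponent f φ (nodeParam θ s) v x) := fun v => by
      rw [exponent_eq_add M.mercer hθ s, restExponent_update, nodeExponent_update,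
        Function.update_self, Real.exp_add]
      ring
    have hr : 0 ≤ Real.exp (restExponent f φ θ s x) / c := by positivity
    have hZx : 0 < ∫ u, Real.exp (nodeExponent f φ (nodeParam θ s) u x) ∂ν := hZ x
    have hmn : Measurable fun v => nodeExponent f φ (nodeParam θ s) v x :=
      M.measurable_nodeExponent_left _ x
    have hmu : Measurable fun u : 𝒳 => Function.update x s u := measurable_update x
    have hmAu := hmA.comp hmu
    simp only [Function.comp_def] at hmAu
    simp only [hexp, nodeExponent_update, Z, Function.update_idem]
    simp_rw [div_eq_inv_mul (Real.exp (nodeExponent _ _ _ _ _)),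
      ENNReal.ofReal_mul hr, ENNReal.ofReal_mul (inv_nonneg.2 hZx.le), mul_assoc]
    rw [lintegral_const_mul _ (by fun_prop), lintegral_const_mul _ (by fun_prop),
      lintegral_const_mul _ (by fun_prop), lintegral_mul_const _ (by fun_prop),
      ← ofReal_integral_eq_lintegral_ofReal (M.integrable_exp_nodeExponent _ x)
        (Eventually.of_forall fun u => (Real.exp_pos _).le), ← mul_assoc (ENNReal.ofReal (∫ _, _ ∂ν)),
      ← ENNReal.ofReal_mul hZx.le, mul_inv_cancel₀ hZx.ne', ENNReal.ofReal_one, one_mul]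

end KernelModel

end Joint

/-! ### Mercer kernels that split additively are constant -/

section Rigidity

variable {Ω : Type*} [MeasurableSpace Ω] {μ : Measure Ω} {φ : Ω → Ω → ℝ}

theorem IsMercerKernel.integrable_left (hφ : IsMercerKernel φ)
    (hm : Measurable (Function.uncurry φ)) (hr : HasExpMoments μ fun u => √(φ u u)) (y : Ω) :
    Integrable (fun u => φ u y) μ := by
  refine hr.integrable_of_norm_le (hm.comp measurable_prodMk_right).aestronglyMeasurable 1
    (√(φ y y)) fun u => ?_
  rw [Real.norm_eq_abs, Real.norm_eq_abs, abs_of_nonneg (Real.sqrt_nonneg _), one_mul, mul_comm]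
  refine (hφ.abs_le u y).trans ?_
  gcongr
  linarith [Real.add_one_le_exp √(φ u u)]

variable [IsProbabilityMeasure μ]

/-- If the off-diagonal part of a Mercer kernel splits as `k(u) + k(y) + H` with `k` centred, then
`k` vanishes almost everywhere. -/
theorem IsMercerKernel.ae_eq_zero_of_ae_split (hφ : IsMercerKernel φ)
    (hm : Measurable (Function.uncurry φ)) (hr : HasExpMoments μ fun u => √(φ u u)) {k : Ω → ℝ}
    (hk : Measurable k) {C H : ℝ} (hkb : ∀ u, |k u| ≤ C * Real.exp √(φ u u))
    (hk0 : ∫ u, k u ∂μ = 0)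
    (h : ∀ᵐ z ∂(μ.prod μ), φ z.1 z.2 = k z.1 + k z.2 + H) : ∀ᵐ u ∂μ, k u = 0 := by
  have hki : Integrable k μ := hr.integrable_of_norm_le hk.aestronglyMeasurable 1 C fun u => by
    simpa [abs_of_nonneg (Real.sqrt_nonneg _)] using hkb u
  have hk2 : Integrable (fun u => k u ^ 2) μ :=
    hr.integrable_of_norm_le (hk.pow_const 2).aestronglyMeasurable 2 (C ^ 2) fun u => by
      rw [Real.norm_eq_abs, Real.norm_eq_abs, abs_of_nonneg (Real.sqrt_nonneg _), abs_pow, two_mul,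
        Real.exp_add]
      calc |k u| ^ 2 ≤ (C * Real.exp √(φ u u)) ^ 2 := by gcongr; exact hkb u
        _ = _ := by ring
  set B := ∫ u, k u ^ 2 ∂μ with hB
  -- Test positivity against `g = ε - k`: since `∫ g = ε` and `∫ k g = -B`, the split evaluates the
  -- form to the right-hand side.
  have hmain : ∀ ε : ℝ, 0 ≤ -2 * ε * B + H * ε ^ 2 := fun ε => by
    set g : Ω → ℝ := fun u => ε - k u with hg
    have hgm : Measurable g := by fun_prop
    have hgi : Integrable g μ := (integrable_const ε).sub hki
    have hkg : Integrable (fun u => k u * g u) μ := by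
      refine ((hki.const_mul ε).sub hk2).congr (Eventually.of_forall fun u => ?_)
      simp only [hg, Pi.sub_apply]; ring
    have hgI : ∫ u, g u ∂μ = ε := by
      rw [hg, integral_sub (integrable_const ε) hki, hk0]; simp
    have hkgI : ∫ u, k u * g u ∂μ = -B := by
      have : ∀ u, k u * g u = ε * k u - k u ^ 2 := fun u => by simp only [hg]; ring
      simp_rw [this]
      rw [integral_sub (hki.const_mul ε) hk2, integral_const_mul, hk0, hB]; ring
    have i1 := hkg.mul_prod hgi
    have i2 := hgi.mul_prod hkg
    have i3 := (hgi.mul_prod hgi).const_mul H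
    have hae : (fun z : Ω × Ω => (k z.1 * g z.1 * g z.2 + g z.1 * (k z.2 * g z.2))
        + H * (g z.1 * g z.2)) =ᵐ[μ.prod μ] fun z => φ z.1 z.2 * g z.1 * g z.2 := by
      filter_upwards [h] with z hz
      rw [hz]; ring
    have hd : Integrable (fun u => φ u u * g u * g u) μ := by
      have hmd : Measurable fun u : Ω => (u, u) := by fun_prop
      refine hr.integrable_of_norm_le
        (((hm.comp hmd).mul hgm).mul hgm).aestronglyMeasurable 3 (2 * (|ε| + C) ^ 2) fun u => ?_
      have hrn := Real.sqrt_nonneg (φ u u)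
      have h1 : φ u u ≤ 2 * Real.exp √(φ u u) := by
        have := sq_le_two_mul_exp hrn
        rwa [Real.sq_sqrt (hφ.diag_nonneg u)] at this
      have h2 : |g u| ≤ (|ε| + C) * Real.exp √(φ u u) := by
        refine (abs_sub _ _).trans ?_
        have := hkb u
        have h3 : |ε| * 1 ≤ |ε| * Real.exp √(φ u u) := by
          gcongr; exact Real.one_le_exp hrn
        linarith
      rw [Real.norm_eq_abs, Real.norm_eq_abs, abs_of_nonneg hrn, abs_mul, abs_mul,
        abs_of_nonneg (hφ.diag_nonneg u)]
      calc φ u u * |g u| * |g u| = φ u u * |g u| ^ 2 := by ring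
        _ ≤ (2 * Real.exp √(φ u u)) * ((|ε| + C) * Real.exp √(φ u u)) ^ 2 := by
          gcongr
        _ = 2 * (|ε| + C) ^ 2 * Real.exp (3 * √(φ u u)) := by
          rw [show 3 * √(φ u u) = √(φ u u) + √(φ u u) + √(φ u u) by ring, Real.exp_add,
            Real.exp_add]
          ring
    have i12 : Integrable (fun z : Ω × Ω => k z.1 * g z.1 * g z.2 + g z.1 * (k z.2 * g z.2))
        (μ.prod μ) := i1.add i2
    have hpos := hφ.integral_mul_mul_nonneg hd ((i12.add i3).congr hae)
    rw [← integral_congr_ae hae, integral_add i12 i3, integral_add i1 i2,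
      integral_const_mul, integral_prod_mul (fun u => k u * g u) g,
      integral_prod_mul g (fun u => k u * g u), integral_prod_mul g g, hgI, hkgI] at hpos
    linarith
  have hB0 : B = 0 := by
    refine le_antisymm ?_ (integral_nonneg fun u => sq_nonneg _)
    by_contra! hBpos
    -- For a small positive `ε` the negative linear term wins; this choice is small enough for any
    -- sign of `H`.
    have h1 := hmain (B / (|H| + 1))
    have hH : 0 < |H| + 1 := by positivity
    have h2 : -2 * (B / (|H| + 1)) * B + H * (B / (|H| + 1)) ^ 2
        = (B / (|H| + 1)) ^ 2 * (H - 2 * (|H| + 1)) := by field_simp; ring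
    rw [h2] at h1
    have h3 : 0 < (B / (|H| + 1)) ^ 2 := by positivity
    have h4 : H - 2 * (|H| + 1) < 0 := by linarith [le_abs_self H, abs_nonneg H]
    nlinarith
  rw [hB, integral_eq_zero_iff_of_nonneg (fun u => sq_nonneg _) hk2] at hB0
  filter_upwards [hB0] with u hu
  simpa using hu

/-- A Mercer kernel that is almost everywhere a sum of functions of its two arguments is almost
everywhere constant. -/
theorem IsMercerKernel.ae_const_of_ae_add (hφ : IsMercerKernel φ)
    (hm : Measurable (Function.uncurry φ)) (hr : HasExpMoments μ fun u => √(φ u u)) {a d : Ω → ℝ}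
    (ha : Measurable a) (h : ∀ᵐ y ∂μ, ∀ᵐ u ∂μ, φ u y = a u + d y) :
    ∃ H : ℝ, ∀ᵐ z ∂(μ.prod μ), φ z.1 z.2 = H := by
  have hφi := hφ.integrable_left hm hr
  obtain ⟨y₀, hy₀⟩ := h.exists
  have hai : Integrable a μ := by
    refine ((hφi y₀).sub (integrable_const (d y₀))).congr ?_
    filter_upwards [hy₀] with u hu
    simp [hu]
  set A := ∫ u, a u ∂μ
  set η : Ω → ℝ := fun y => ∫ u, φ u y ∂μ with hη
  have hηm : Measurable η :=
    (hm.stronglyMeasurable.integral_prod_left' (μ := μ)).measurable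
  have hsplit : ∀ᵐ y ∂μ, ∀ᵐ u ∂μ, φ u y = a u + (η y - A) := by
    filter_upwards [h] with y hy
    have : η y = A + d y := by
      rw [hη]
      simp only
      rw [integral_congr_ae hy, integral_add hai (integrable_const _)]
      simp [A]
    filter_upwards [hy] with u hu
    rw [hu, this]; ring
  have hsplit_prod : ∀ᵐ z ∂(μ.prod μ), φ z.2 z.1 = a z.2 + (η z.1 - A) := by
    refine Measure.ae_prod_iff_ae_ae ?_ |>.2 hsplit
    exact measurableSet_eq_fun (hm.comp measurable_swap) (by fun_prop)
  have hηb : ∀ y, |η y| ≤ (∫ u, Real.exp √(φ u u) ∂μ) * √(φ y y) := fun y => by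
    have hE : Integrable (fun u => Real.exp √(φ u u)) μ := by
      have := hr.2 1
      refine this.congr (Eventually.of_forall fun u => ?_)
      simp [abs_of_nonneg (Real.sqrt_nonneg _)]
    rw [← integral_mul_const]
    refine (norm_integral_le_integral_norm _).trans (integral_mono (hφi y).norm (hE.mul_const _)
      fun u => ?_)
    refine (hφ.abs_le u y).trans ?_
    gcongr
    linarith [Real.add_one_le_exp √(φ u u)]
  set R := ∫ u, Real.exp √(φ u u) ∂μ
  have hR : 0 ≤ R := integral_nonneg fun u => (Real.exp_pos _).le
  have hηb' : ∀ y, |η y| ≤ R * Real.exp √(φ y y) := fun y => (hηb y).trans (by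
    gcongr
    linarith [Real.add_one_le_exp √(φ y y)])
  have hηi : Integrable η μ := hr.integrable_of_norm_le hηm.aestronglyMeasurable 1 R fun u => by
    simpa [abs_of_nonneg (Real.sqrt_nonneg _)] using hηb' u
  set H := ∫ y, η y ∂μ with hH
  -- Integrating the split over the other variable and using symmetry shows that `a` and `η` differ
  -- by a constant, so the split becomes symmetric with `k = η - H`.
  have haη : ∀ᵐ u ∂μ, η u = a u + (H - A) := by
    have h1 : ∀ᵐ u ∂μ, ∀ᵐ y ∂μ, φ u y = a u + (η y - A) := by
      have h2 : ∀ᵐ z ∂(μ.prod μ), φ z.1 z.2 = a z.1 + (η z.2 - A) := by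
        have := Measure.measurePreserving_swap (μ := μ) (ν := μ) |>.quasiMeasurePreserving.ae
          hsplit_prod
        exact this
      exact Measure.ae_ae_of_ae_prod h2
    filter_upwards [h1] with u hu
    have h3 : η u = ∫ y, φ u y ∂μ := integral_congr_ae (Eventually.of_forall fun y => hφ.symm y u)
    have h4 : Integrable (fun y => η y - A) μ := hηi.sub (integrable_const A)
    rw [h3, integral_congr_ae hu, integral_add (integrable_const _) h4,
      integral_sub hηi (integrable_const A)]
    simp [hH]
  have hfin : ∀ᵐ z ∂(μ.prod μ), φ z.1 z.2 = (η z.1 - H) + (η z.2 - H) + H := by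
    refine Measure.ae_prod_iff_ae_ae ?_ |>.2 ?_
    · exact measurableSet_eq_fun hm (by fun_prop)
    · filter_upwards [hsplit] with y hy
      filter_upwards [hy, haη] with u hu hau
      rw [hφ.symm y u, hu, hau]; ring
  have hz := hφ.ae_eq_zero_of_ae_split hm hr (k := fun u => η u - H) (by fun_prop)
    (C := R + |H|) (fun u => by
      refine (abs_sub _ _).trans ?_
      have := hηb' u
      have h3 : |H| * 1 ≤ |H| * Real.exp √(φ u u) := by
        gcongr; exact Real.one_le_exp (Real.sqrt_nonneg _)
      linarith)
    (by rw [integral_sub hηi (integrable_const _)]; simp [hH]) hfin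
  refine ⟨H, ?_⟩
  have hz1 : ∀ᵐ z ∂(μ.prod μ), η z.1 - H = 0 := Measure.quasiMeasurePreserving_fst.ae hz
  have hz2 : ∀ᵐ z ∂(μ.prod μ), η z.2 - H = 0 := Measure.quasiMeasurePreserving_snd.ae hz
  filter_upwards [hfin, hz1, hz2] with z h1 h2 h3
  rw [h1, h2, h3]; ring

end Rigidity

/-! ### Perturbing a single interaction -/

section Perturb

variable {𝒳 : Type*} {φ : 𝒳 → 𝒳 → ℝ} {f : 𝒳 → ℝ} {p : ℕ}

/-- Shift the parameter of the ordered pair `(a, b)` by `ε`. -/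
def shiftPair (θ : Fin p → Fin p → ℝ) (a b : Fin p) (ε : ℝ) : Fin p → Fin p → ℝ :=
  fun i j => θ i j + if i = a ∧ j = b then ε else 0

/-- The exponent reads only entries above the diagonal, so one ordered entry may be shifted without
restoring symmetry. -/
theorem exponent_shiftPair (θ : Fin p → Fin p → ℝ) {a b : Fin p} (hab : a < b) (ε : ℝ)
    (x : Fin p → 𝒳) :
    exponent f φ (shiftPair θ a b ε) x = exponent f φ θ x + ε * φ (x a) (x b) := by
  simp only [exponent, shiftPair, add_mul, Finset.sum_add_distrib, ite_and, ite_mul, zero_mul]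
  rw [← add_assoc]
  congr 1
  rw [Finset.sum_eq_single a]
  · simp [hab]
  · intro i _ hi
    simp [hi]
  · simp

theorem exists_normalizable_shiftPair [MeasurableSpace 𝒳] {ν : Measure 𝒳}
    {θ : Fin p → Fin p → ℝ} (hA : ∀ᶠ θ' in 𝓝 θ, Normalizable ν f φ θ') (a b : Fin p) :
    ∃ ε : ℝ, 0 < ε ∧ Normalizable ν f φ (shiftPair θ a b ε) ∧
      Normalizable ν f φ (shiftPair θ a b (-ε)) := by
  have hc : Continuous fun ε : ℝ => shiftPair θ a b ε := by
    refine continuous_pi fun i => continuous_pi fun j => continuous_const.add ?_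
    split_ifs <;> fun_prop
  have h0 : shiftPair θ a b 0 = θ := by
    ext i j; simp [shiftPair]
  have hT : Tendsto (fun ε : ℝ => shiftPair θ a b ε) (𝓝 0) (𝓝 θ) := by
    simpa [h0] using hc.tendsto 0
  obtain ⟨δ, hδ, h⟩ := Metric.eventually_nhds_iff.1 (hT.eventually hA)
  have hd : |δ| / 2 < δ := by rw [abs_of_pos hδ]; linarith
  exact ⟨δ / 2, by positivity, h (by simpa [Real.dist_eq] using hd),
    h (by simpa [Real.dist_eq] using hd)⟩

theorem kernel_eval_update {s : Fin p} (x : Fin p → 𝒳) (u : 𝒳) (t : {t : Fin p // t ≠ s}) :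
    φ (Function.update x s u s) (Function.update x s u t) = φ u (x t) := by
  rw [Function.update_self, Function.update_of_ne t.2]

end Perturb

/-! ### Moments of the score and of the curvature -/

section Joint

variable {𝒳 : Type*} [MeasurableSpace 𝒳] {ν : Measure 𝒳} {φ : 𝒳 → 𝒳 → ℝ} {f : 𝒳 → ℝ} {p : ℕ}
  {θ : Fin p → Fin p → ℝ} {s : Fin p}

theorem curvature_nonneg (θs : NodeParam s) (x : Fin p → 𝒳) (Δ : NodeParam s) :
    0 ≤ curvature ν f φ θs x Δ :=
  integral_nonneg fun u => by positivity

namespace KernelModel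

theorem measurable_kernel_eval (M : KernelModel ν f φ) (a b : Fin p) :
    Measurable fun x : Fin p → 𝒳 => φ (x a) (x b) := by
  have h2 : Measurable fun x : Fin p → 𝒳 => (x a, x b) := by fun_prop
  exact M.measurable_kernel.comp h2

theorem condMean_apply (M : KernelModel ν f φ) (θs : NodeParam s) (x : Fin p → 𝒳)
    (t : {t : Fin p // t ≠ s}) :
    condMean ν f φ θs x t = ∫ u, φ u (x t) ∂(condLaw ν f φ θs x) := by
  have := (EuclideanSpace.proj t : NodeParam s →L[ℝ] ℝ).integral_comp_comm
    (M.hasExpMoments_feature θs x).integrable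
  exact this.symm

variable [SigmaFinite ν] [NeZero ν]

/-- Resampling preserves the joint law, and `ν` is absolutely continuous with respect to each
conditional law. -/
theorem ae_update_of_ae (M : KernelModel ν f φ) (hN : Normalizable ν f φ θ)
    (hθ : ∀ s t, θ s t = θ t s) (t : Fin p) {q : (Fin p → 𝒳) → Prop}
    (h : ∀ᵐ x ∂(jointLaw ν f φ θ), q x) :
    ∀ᵐ x ∂(jointLaw ν f φ θ), ∀ᵐ u ∂ν, q (Function.update x t u) := by
  have := isProbabilityMeasure_jointLaw hN
  have hT : Measurable fun z : (Fin p → 𝒳) × 𝒳 => Function.update z.1 t z.2 := by fun_prop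
  rw [← M.map_update_compProd hN hθ t] at h
  have h1 := Measure.ae_ae_of_ae_compProd (ae_of_ae_map hT.aemeasurable h)
  filter_upwards [h1] with x hx
  exact (absolutelyContinuous_tilted (M.integrable_exp_nodeExponent (nodeParam θ t) x)).ae_le hx

theorem ae_of_ae_update (M : KernelModel ν f φ) (hN : Normalizable ν f φ θ)
    (hθ : ∀ s t, θ s t = θ t s) (t : Fin p) {q : (Fin p → 𝒳) → Prop}
    (hq : MeasurableSet {x | q x})
    (h : ∀ᵐ x ∂(jointLaw ν f φ θ), ∀ᵐ u ∂ν, q (Function.update x t u)) :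
    ∀ᵐ x ∂(jointLaw ν f φ θ), q x := by
  have := isProbabilityMeasure_jointLaw hN
  have hT : Measurable fun z : (Fin p → 𝒳) × 𝒳 => Function.update z.1 t z.2 := by fun_prop
  rw [← M.map_update_compProd hN hθ t, ae_map_iff hT.aemeasurable hq]
  refine Measure.ae_compProd_of_ae_ae (hT hq) ?_
  filter_upwards [h] with x hx
  exact (tilted_absolutelyContinuous ν _).ae_le hx

/-- The tower property for conditioning on all nodes but `s`, read off from invariance under
resampling. -/
theorem integral_resample (M : KernelModel ν f φ) (hN : Normalizable ν f φ θ)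
    (hθ : ∀ s t, θ s t = θ t s) (s : Fin p) {h : (Fin p → 𝒳) → ℝ}
    (hi : Integrable h (jointLaw ν f φ θ)) :
    Integrable (fun x => ∫ u, h (Function.update x s u) ∂(condLaw ν f φ (nodeParam θ s) x))
      (jointLaw ν f φ θ) ∧
    ∫ x, ∫ u, h (Function.update x s u) ∂(condLaw ν f φ (nodeParam θ s) x) ∂(jointLaw ν f φ θ)
      = ∫ x, h x ∂(jointLaw ν f φ θ) := by
  have := isProbabilityMeasure_jointLaw hN
  have hT : Measurable fun z : (Fin p → 𝒳) × 𝒳 => Function.update z.1 s z.2 := by fun_prop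
  have hmap := M.map_update_compProd hN hθ s
  have hi' := hi
  rw [← hmap] at hi'
  have hc : Integrable (fun z : (Fin p → 𝒳) × 𝒳 => h (Function.update z.1 s z.2))
      (jointLaw ν f φ θ ⊗ₘ M.condKernel (nodeParam θ s)) := hi'.comp_measurable hT
  refine ⟨Integrable.integral_compProd hc, ?_⟩
  have h1 := integral_map hT.aemeasurable hi'.1
  rw [hmap, Measure.integral_compProd hc] at h1
  exact h1.symm

/-- Normalizability at shifts of both signs bounds `exp (± ε φ)` in mean, and together these
dominate `φ²`. -/
theorem integrable_kernel_sq_of_lt (M : KernelModel ν f φ)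
    (hA : ∀ᶠ θ' in 𝓝 θ, Normalizable ν f φ θ') {a b : Fin p} (hab : a < b) :
    Integrable (fun x => φ (x a) (x b) ^ 2) (jointLaw ν f φ θ) := by
  obtain ⟨ε, hε, h1, h2⟩ := exists_normalizable_shiftPair hA a b
  have hme := M.measurable_exponent θ
  have hmk := M.measurable_kernel_eval a b
  rw [jointLaw_eq_tilted hA.self_of_nhds, integrable_tilted_iff hA.self_of_nhds]
  refine ((h1.add h2).const_mul (2 / ε ^ 2)).mono'
    ((Real.measurable_exp.comp hme).mul (hmk.pow_const 2)).aestronglyMeasurable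
    (Eventually.of_forall fun x => ?_)
  simp only [Pi.add_apply, exponent_shiftPair θ hab, Real.exp_add, smul_eq_mul, norm_mul,
    Real.norm_eq_abs, Real.abs_exp, abs_pow, sq_abs]
  have h3 : (ε * φ (x a) (x b)) ^ 2
      ≤ 2 * (Real.exp (ε * φ (x a) (x b)) + Real.exp (-ε * φ (x a) (x b))) := by
    have := sq_le_two_mul_exp (abs_nonneg (ε * φ (x a) (x b)))
    rw [sq_abs] at this
    rw [neg_mul]
    rcases abs_cases (ε * φ (x a) (x b)) with ⟨h, _⟩ | ⟨h, _⟩ <;> rw [h] at this <;>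
      linarith [Real.exp_pos (ε * φ (x a) (x b)), Real.exp_pos (-(ε * φ (x a) (x b)))]
  calc Real.exp (exponent f φ θ x) * φ (x a) (x b) ^ 2
      = Real.exp (exponent f φ θ x) * ((ε * φ (x a) (x b)) ^ 2 / ε ^ 2) := by
        field_simp
    _ ≤ Real.exp (exponent f φ θ x) * ((2 * (Real.exp (ε * φ (x a) (x b))
        + Real.exp (-ε * φ (x a) (x b)))) / ε ^ 2) := by gcongr
    _ = _ := by ring

theorem memLp_kernel_eval (M : KernelModel ν f φ) (hA : ∀ᶠ θ' in 𝓝 θ, Normalizable ν f φ θ')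
    {a b : Fin p} (hab : a ≠ b) :
    MemLp (fun x => φ (x a) (x b)) 2 (jointLaw ν f φ θ) := by
  rw [memLp_two_iff_integrable_sq (M.measurable_kernel_eval a b).aestronglyMeasurable]
  rcases hab.lt_or_gt with h | h
  · exact M.integrable_kernel_sq_of_lt hA h
  · simp_rw [M.mercer.symm (_ : 𝒳) ((_ : Fin p → 𝒳) b)]
    exact M.integrable_kernel_sq_of_lt hA h

theorem measurable_condMean (M : KernelModel ν f φ) (θs : NodeParam s) :
    Measurable (condMean ν f φ θs) :=
  ((measurable_feature M.measurable_kernel).stronglyMeasurable.integral_kernel_prod_right'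
    (κ := M.condKernel θs)).measurable

theorem measurable_centred (M : KernelModel ν f φ) (θs : NodeParam s) :
    Measurable fun z : (Fin p → 𝒳) × 𝒳 => centred ν f φ θs z.1 z.2 :=
  (measurable_feature M.measurable_kernel).sub ((M.measurable_condMean θs).comp measurable_fst)

/-- Conditional Jensen: the squared conditional mean is at most the conditional mean of the square.
-/
theorem memLp_condMean (M : KernelModel ν f φ) (hA : ∀ᶠ θ' in 𝓝 θ, Normalizable ν f φ θ')
    (hθ : ∀ s t, θ s t = θ t s) (t : {t : Fin p // t ≠ s}) :
    MemLp (fun x => condMean ν f φ (nodeParam θ s) x t) 2 (jointLaw ν f φ θ) := by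
  have hmt : Measurable fun x => condMean ν f φ (nodeParam θ s) x t := by
    have := M.measurable_condMean (nodeParam θ s)
    fun_prop
  rw [memLp_two_iff_integrable_sq hmt.aestronglyMeasurable]
  have hi := ((memLp_two_iff_integrable_sq (M.measurable_kernel_eval s t).aestronglyMeasurable).1
    (M.memLp_kernel_eval hA t.2.symm))
  refine (M.integral_resample hA.self_of_nhds hθ s hi).1.mono'
    (hmt.pow_const 2).aestronglyMeasurable (Eventually.of_forall fun x => ?_)
  have := M.isProbabilityMeasure_condLaw (nodeParam θ s) x
  simp only [kernel_eval_update]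
  rw [Real.norm_eq_abs, abs_of_nonneg (sq_nonneg _), M.condMean_apply]
  have hE := M.hasExpMoments_feature (nodeParam θ s) x
  have hmu : Measurable fun u => φ u (x t) := M.measurable_kernel.comp measurable_prodMk_right
  have hle : ∀ u, |φ u (x t)| ≤ ‖feature φ s x u‖ := fun u =>
    PiLp.norm_apply_le (feature φ s x u) t
  refine even_two.convexOn_pow.map_integral_le (continuous_pow 2).continuousOn isClosed_univ
    (Eventually.of_forall fun _ => Set.mem_univ _) ?_ ?_
  · exact hE.integrable.norm.mono' hmu.aestronglyMeasurable (Eventually.of_forall hle)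
  · refine hE.integrable_of_norm_le (hmu.pow_const 2).aestronglyMeasurable 1 2 fun u => ?_
    rw [Function.comp_apply, Real.norm_eq_abs, abs_pow, one_mul]
    exact (pow_le_pow_left₀ (abs_nonneg _) (hle u) 2).trans (sq_le_two_mul_exp (norm_nonneg _))

theorem memLp_score (M : KernelModel ν f φ) (hA : ∀ᶠ θ' in 𝓝 θ, Normalizable ν f φ θ')
    (hθ : ∀ s t, θ s t = θ t s) (t : {t : Fin p // t ≠ s}) :
    MemLp (fun x => centred ν f φ (nodeParam θ s) x (x s) t) 2 (jointLaw ν f φ θ) :=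
  (M.memLp_kernel_eval hA t.2.symm).sub (M.memLp_condMean hA hθ t)

theorem integral_score (M : KernelModel ν f φ) (hA : ∀ᶠ θ' in 𝓝 θ, Normalizable ν f φ θ')
    (hθ : ∀ s t, θ s t = θ t s) (t : {t : Fin p // t ≠ s}) :
    ∫ x, centred ν f φ (nodeParam θ s) x (x s) t ∂(jointLaw ν f φ θ) = 0 := by
  have := isProbabilityMeasure_jointLaw hA.self_of_nhds
  have h1 := (M.memLp_kernel_eval hA t.2.symm).integrable (by norm_num)
  have h2 := (M.memLp_condMean hA hθ t).integrable (by norm_num)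
  have h3 := (M.integral_resample hA.self_of_nhds hθ s h1).2
  simp only [kernel_eval_update, ← M.condMean_apply] at h3
  have h4 := integral_sub h1 h2
  rw [h3, sub_self] at h4
  exact h4

/-- The matrix entries of the curvature form. -/
noncomputable def curvatureEntry (ν : Measure 𝒳) (f : 𝒳 → ℝ) (φ : 𝒳 → 𝒳 → ℝ) (θs : NodeParam s)
    (t t' : {t : Fin p // t ≠ s}) (x : Fin p → 𝒳) : ℝ :=
  ∫ u, centred ν f φ θs x u t * centred ν f φ θs x u t' * Real.exp (-‖centred ν f φ θs x u‖)
    ∂(condLaw ν f φ θs x)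

theorem abs_curvatureEntry_integrand_le (v : NodeParam s) (t t' : {t : Fin p // t ≠ s}) :
    |v t * v t' * Real.exp (-‖v‖)| ≤ 2 := by
  rw [abs_mul, abs_mul, Real.abs_exp]
  refine le_trans ?_ (sq_mul_exp_neg_le_two (norm_nonneg v))
  rw [sq]
  gcongr
  · exact PiLp.norm_apply_le v t
  · exact PiLp.norm_apply_le v t'

theorem measurable_curvatureEntry_integrand (M : KernelModel ν f φ) (θs : NodeParam s)
    (t t' : {t : Fin p // t ≠ s}) :
    Measurable fun z : (Fin p → 𝒳) × 𝒳 => centred ν f φ θs z.1 z.2 t * centred ν f φ θs z.1 z.2 t'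
      * Real.exp (-‖centred ν f φ θs z.1 z.2‖) := by
  have := M.measurable_centred θs
  fun_prop

theorem memLp_curvatureEntry (M : KernelModel ν f φ) (hN : Normalizable ν f φ θ)
    (θs : NodeParam s) (t t' : {t : Fin p // t ≠ s}) :
    MemLp (curvatureEntry ν f φ θs t t') 2 (jointLaw ν f φ θ) := by
  have := isProbabilityMeasure_jointLaw hN
  have hmeas : StronglyMeasurable (curvatureEntry ν f φ θs t t') :=
    (M.measurable_curvatureEntry_integrand θs t t').stronglyMeasurable.integral_kernel_prod_right'
      (κ := M.condKernel θs)
  refine MemLp.of_bound hmeas.aestronglyMeasurable 2 (Eventually.of_forall fun x => ?_)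
  have := M.isProbabilityMeasure_condLaw θs x
  refine (norm_integral_le_of_norm_le_const (Eventually.of_forall fun u =>
    abs_curvatureEntry_integrand_le _ t t')).trans ?_
  simp

theorem curvature_eq_sum (M : KernelModel ν f φ) (θs : NodeParam s) (x : Fin p → 𝒳)
    (Δ : NodeParam s) :
    curvature ν f φ θs x Δ = ∑ t, ∑ t', Δ t * Δ t' * curvatureEntry ν f φ θs t t' x := by
  have := M.isProbabilityMeasure_condLaw θs x
  have hI : ∀ t t', Integrable (fun u => Δ t * Δ t' * (centred ν f φ θs x u t
      * centred ν f φ θs x u t' * Real.exp (-‖centred ν f φ θs x u‖))) (condLaw ν f φ θs x) :=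
    fun t t' => Integrable.const_mul ((integrable_const (2 : ℝ)).mono'
      ((M.measurable_curvatureEntry_integrand θs t t').comp
        measurable_prodMk_left).aestronglyMeasurable
      (Eventually.of_forall fun u => abs_curvatureEntry_integrand_le _ t t')) _
  have hexp : ∀ u, ⟪Δ, centred ν f φ θs x u⟫ ^ 2 * Real.exp (-‖centred ν f φ θs x u‖)
      = ∑ t, ∑ t', Δ t * Δ t' * (centred ν f φ θs x u t
      * centred ν f φ θs x u t' * Real.exp (-‖centred ν f φ θs x u‖)) := fun u => by
    have : ⟪Δ, centred ν f φ θs x u⟫ = ∑ t, Δ t * centred ν f φ θs x u t := by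
      simp [PiLp.inner_apply, mul_comm]
    rw [this, sq, Finset.sum_mul_sum, Finset.sum_mul]
    refine Finset.sum_congr rfl fun t _ => ?_
    rw [Finset.sum_mul]
    exact Finset.sum_congr rfl fun t' _ => by ring
  simp only [curvature, hexp]
  rw [integral_finsetSum _ fun t _ => integrable_finsetSum _ fun t' _ => hI t t']
  simp_rw [integral_finsetSum _ fun t' _ => hI _ t', integral_const_mul]
  rfl

theorem integral_curvature_eq_sum (M : KernelModel ν f φ) (hN : Normalizable ν f φ θ)
    (θs : NodeParam s) (Δ : NodeParam s) :
    Integrable (fun x => curvature ν f φ θs x Δ) (jointLaw ν f φ θ) ∧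
    ∫ x, curvature ν f φ θs x Δ ∂(jointLaw ν f φ θ)
      = ∑ t, ∑ t', Δ t * Δ t' * ∫ x, curvatureEntry ν f φ θs t t' x ∂(jointLaw ν f φ θ) := by
  have := isProbabilityMeasure_jointLaw hN
  have hI : ∀ t t', Integrable (fun x => Δ t * Δ t' * curvatureEntry ν f φ θs t t' x)
      (jointLaw ν f φ θ) := fun t t' =>
    ((M.memLp_curvatureEntry hN θs t t').integrable (by norm_num)).const_mul _
  simp_rw [M.curvature_eq_sum θs _ Δ]
  refine ⟨integrable_finsetSum _ fun t _ => integrable_finsetSum _ fun t' _ => hI t t', ?_⟩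
  rw [integral_finsetSum _ fun t _ => integrable_finsetSum _ fun t' _ => hI t t']
  simp_rw [integral_finsetSum _ fun t' _ => hI _ t', integral_const_mul]

end KernelModel

end Joint

/-! ### Uniform lower bounds for quadratic forms -/

section QuadraticForm

variable {ι : Type*} [Fintype ι]

theorem exists_pos_mul_sq_norm_le {A : ι → ι → ℝ}
    (hA : ∀ Δ : EuclideanSpace ℝ ι, Δ ≠ 0 → 0 < ∑ t, ∑ t', Δ t * Δ t' * A t t') :
    ∃ m : ℝ, 0 < m ∧ ∀ Δ : EuclideanSpace ℝ ι, m * ‖Δ‖ ^ 2 ≤ ∑ t, ∑ t', Δ t * Δ t' * A t t' := by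
  -- The sphere is empty in dimension zero; otherwise compactness gives the least value on it.
  rcases (Metric.sphere (0 : EuclideanSpace ℝ ι) 1).eq_empty_or_nonempty with he | hne
  · refine ⟨1, one_pos, fun Δ => ?_⟩
    have h0 : Δ = 0 := by
      by_contra h
      have : ‖Δ‖⁻¹ • Δ ∈ Metric.sphere (0 : EuclideanSpace ℝ ι) 1 := by
        rw [mem_sphere_zero_iff_norm, norm_smul, norm_inv, norm_norm,
          inv_mul_cancel₀ (norm_ne_zero_iff.2 h)]
      simp [he] at this
    simp [h0]
  · obtain ⟨Δ₀, hΔ₀, hmin⟩ := (isCompact_sphere (0 : EuclideanSpace ℝ ι) 1).exists_isMinOn hne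
      (f := fun Δ => ∑ t, ∑ t', Δ t * Δ t' * A t t') (by fun_prop)
    refine ⟨_, hA Δ₀ fun h => ?_, fun Δ => ?_⟩
    · simp [h] at hΔ₀
    · rcases eq_or_ne Δ 0 with rfl | h
      · simp
      have hn : ‖Δ‖ ≠ 0 := norm_ne_zero_iff.2 h
      have hmem : ‖Δ‖⁻¹ • Δ ∈ Metric.sphere (0 : EuclideanSpace ℝ ι) 1 := by
        rw [mem_sphere_zero_iff_norm, norm_smul, norm_inv, norm_norm, inv_mul_cancel₀ hn]
      have h1 := mul_le_mul_of_nonneg_right (hmin hmem) (sq_nonneg ‖Δ‖)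
      refine h1.trans_eq ?_
      simp only [Finset.sum_mul, PiLp.smul_apply, smul_eq_mul]
      refine Finset.sum_congr rfl fun t _ => Finset.sum_congr rfl fun t' _ => ?_
      field_simp

/-- An entrywise error `ε` costs at most `ε ‖Δ‖₁²`, and `‖Δ‖₁²` is at most the dimension times
`‖Δ‖²`. -/
theorem quadraticForm_perturb {A B : ι → ι → ℝ} {m : ℝ}
    (hA : ∀ Δ : EuclideanSpace ℝ ι, m * ‖Δ‖ ^ 2 ≤ ∑ t, ∑ t', Δ t * Δ t' * A t t') {ε : ℝ}
    (hε : 0 ≤ ε) (hAB : ∀ t t', |B t t' - A t t'| ≤ ε) (Δ : EuclideanSpace ℝ ι) :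
    (m - ε * Fintype.card ι) * ‖Δ‖ ^ 2 ≤ ∑ t, ∑ t', Δ t * Δ t' * B t t' := by
  have h1 : ∑ t, ∑ t', Δ t * Δ t' * A t t' - ∑ t, ∑ t', Δ t * Δ t' * B t t'
      ≤ ε * (∑ t, |Δ t|) ^ 2 := by
    rw [← Finset.sum_sub_distrib, sq, Finset.sum_mul_sum, Finset.mul_sum]
    refine Finset.sum_le_sum fun t _ => ?_
    rw [← Finset.sum_sub_distrib, Finset.mul_sum]
    refine Finset.sum_le_sum fun t' _ => ?_
    rw [← mul_sub]
    refine (le_abs_self _).trans ?_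
    rw [abs_mul, abs_mul, abs_sub_comm, mul_comm]
    exact mul_le_mul_of_nonneg_right (hAB t t') (by positivity)
  have h2 : (∑ t, |Δ t|) ^ 2 ≤ Fintype.card ι * ‖Δ‖ ^ 2 := by
    rw [EuclideanSpace.norm_sq_eq]
    simpa using sq_sum_le_card_mul_sum_sq (s := Finset.univ) (f := fun t => |Δ t|)
  have h3 := mul_le_mul_of_nonneg_left h2 hε
  linarith [hA Δ]

end QuadraticForm

/-! ### Minimality makes the population curvature positive definite -/

section Identifiability

variable {𝒳 : Type*} [MeasurableSpace 𝒳] {ν : Measure 𝒳}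
  {φ : 𝒳 → 𝒳 → ℝ} {f : 𝒳 → ℝ} {p : ℕ} {θ : Fin p → Fin p → ℝ} {s : Fin p}

namespace KernelModel

theorem integrable_exp_potential (M : KernelModel ν f φ) :
    Integrable (fun u => Real.exp (f u)) ν := by
  have := M.measurable_potential
  refine M.integrable_of_abs_le_exp (by fun_prop) 0 1 fun u => ?_
  simp

theorem hasExpMoments_sqrt_diag (M : KernelModel ν f φ) :
    HasExpMoments (ν.tilted f) fun u => √(φ u u) := by
  have hf := M.measurable_potential
  have hd : Measurable fun u : 𝒳 => φ u u :=
    M.measurable_kernel.comp (by fun_prop : Measurable fun x : 𝒳 => (x, x))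
  refine ⟨hd.sqrt.aestronglyMeasurable, fun a => ?_⟩
  rw [integrable_tilted_iff M.integrable_exp_potential]
  have hd' := hd.sqrt
  simp only [smul_eq_mul, Real.norm_eq_abs]
  refine M.integrable_of_abs_le_exp (by fun_prop) a 1 fun u => ?_
  simp [abs_of_nonneg (Real.sqrt_nonneg _), Real.exp_add]

variable [SigmaFinite ν] [NeZero ν]

/-- Minimality excludes kernels that are almost everywhere constant. -/
theorem not_ae_const (M : KernelModel ν f φ) (hN : Normalizable ν f φ θ)
    (hθ : ∀ s t, θ s t = θ t s) (hmin : HasMinimalRepresentation ν f φ θ) {a b : Fin p}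
    (hab : a < b) (H : ℝ) : ¬ ∀ᵐ z ∂(ν.prod ν), φ z.1 z.2 = H := by
  intro hH
  have := isProbabilityMeasure_jointLaw hN
  have := neZero_pi (ν := ν) (p := p)
  have hne : MeasurableSet {z : 𝒳 × 𝒳 | ¬ φ z.1 z.2 = H} :=
    (measurableSet_eq_fun M.measurable_kernel measurable_const).compl
  -- Resampling `a` and then `b` carries the identity from `ν × ν` to the joint law.
  have h1 : ∀ᵐ x ∂(jointLaw ν f φ θ), ∀ᵐ u ∂ν, φ (x a) u = H := by
    refine M.ae_of_ae_update hN hθ a ?_ (Eventually.of_forall fun x => ?_)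
    · have h := (measurable_measure_prodMk_left (ν := ν) hne) (measurableSet_singleton 0)
      exact h.preimage (measurable_pi_apply (X := fun _ : Fin p => 𝒳) a)
    · simp only [Function.update_self]
      exact Measure.ae_ae_of_ae_prod hH
  have h2 : ∀ᵐ x ∂(jointLaw ν f φ θ), φ (x a) (x b) = H := by
    refine M.ae_of_ae_update hN hθ b
      (measurableSet_eq_fun (M.measurable_kernel_eval a b) measurable_const) ?_
    filter_upwards [h1] with x hx
    simpa only [Function.update_self, Function.update_of_ne hab.ne] using hx
  rw [jointLaw_eq_tilted hN] at h2
  -- The shifted exponent differs only by the constant `H`, which normalization absorbs.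
  have h3 : exponent f φ (shiftPair θ a b 1) =ᵐ[Measure.pi fun _ => ν]
      exponent f φ θ + fun _ => H := by
    filter_upwards [(absolutelyContinuous_tilted hN).ae_le h2] with x hx
    simp [exponent_shiftPair θ hab, hx]
  have hN' : Normalizable ν f φ (shiftPair θ a b 1) := by
    refine (hN.mul_const (Real.exp H)).congr ?_
    filter_upwards [h3] with x hx
    simp [hx, Real.exp_add]
  have hJ : jointLaw ν f φ (shiftPair θ a b 1) = jointLaw ν f φ θ := by
    have := isProbabilityMeasure_tilted hN
    rw [jointLaw_eq_tilted hN', jointLaw_eq_tilted hN, tilted_congr h3, ← tilted_tilted hN,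
      tilted_const]
  have := hmin _ hN' hJ a b hab
  simp [shiftPair] at this

/-- The population curvature is positive definite. -/
theorem integral_curvature_pos (M : KernelModel ν f φ) (hN : Normalizable ν f φ θ)
    (hθ : ∀ s t, θ s t = θ t s) (hmin : HasMinimalRepresentation ν f φ θ) {Δ : NodeParam s}
    (hΔ : Δ ≠ 0) :
    0 < ∫ x, curvature ν f φ (nodeParam θ s) x Δ ∂(jointLaw ν f φ θ) := by
  have := isProbabilityMeasure_jointLaw hN
  refine (integral_nonneg fun x => curvature_nonneg _ x Δ).lt_of_ne' fun h0 => ?_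
  rw [integral_eq_zero_iff_of_nonneg (fun x => curvature_nonneg _ x Δ)
    (M.integral_curvature_eq_sum hN _ Δ).1] at h0
  set c := fun x => ⟪Δ, condMean ν f φ (nodeParam θ s) x⟫
  have hF : ∀ᵐ x ∂(jointLaw ν f φ θ), ∀ᵐ u ∂ν, ⟪Δ, feature φ s x u⟫ = c x := by
    filter_upwards [h0] with x hx
    have := M.isProbabilityMeasure_condLaw (nodeParam θ s) x
    rw [Pi.zero_apply, curvature, integral_eq_zero_iff_of_nonneg (fun u => by positivity)
      (integrable_inner_sq_mul_exp_neg_norm (M.hasExpMoments_centred _ x) Δ)] at hx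
    filter_upwards [(absolutelyContinuous_tilted
      (M.integrable_exp_nodeExponent (nodeParam θ s) x)).ae_le hx] with u hu
    simp only [Pi.zero_apply, mul_eq_zero, (Real.exp_pos _).ne', or_false, centred,
      inner_sub_right] at hu
    exact sub_eq_zero.1 (pow_eq_zero_iff two_ne_zero |>.1 hu)
  obtain ⟨t, ht⟩ : ∃ t, Δ t ≠ 0 := by
    by_contra! h
    exact hΔ (by ext t; simpa using h t)
  -- Fix one good configuration whose modifications at coordinate `t` are almost all good;
  -- subtracting the two identities leaves only the `t` term.
  obtain ⟨x, hx, hx'⟩ := (hF.and (M.ae_update_of_ae hN hθ t hF)).exists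
  have hsplit : ∀ᵐ y ∂ν, ∀ᵐ u ∂ν,
      φ u y = φ u (x t) + (c (Function.update x t y) - c x) / Δ t := by
    filter_upwards [hx'] with y hy
    filter_upwards [hx, hy] with u hu hu'
    have hdiff : ⟪Δ, feature φ s (Function.update x t y) u⟫ - ⟪Δ, feature φ s x u⟫
        = Δ t * (φ u y - φ u (x t)) := by
      rw [← inner_sub_right, PiLp.inner_apply, Finset.sum_eq_single t]
      · simp [feature, mul_comm]
      · intro t' _ ht'
        have : (t' : Fin p) ≠ t := fun h => ht' (Subtype.ext h)
        simp [feature, Function.update_of_ne this]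
      · simp
    rw [hu, hu'] at hdiff
    rw [hdiff]
    field_simp
    ring
  -- Rigidity needs a probability measure with exponential moments; tilting `ν` by `f` supplies one
  -- with the same null sets.
  have := isProbabilityMeasure_tilted M.integrable_exp_potential
  have hac := tilted_absolutelyContinuous ν f
  obtain ⟨H, hH⟩ := M.mercer.ae_const_of_ae_add (μ := ν.tilted f) M.measurable_kernel
    M.hasExpMoments_sqrt_diag (a := fun u => φ u (x t))
    (d := fun y => (c (Function.update x t y) - c x) / Δ t)
    (M.measurable_kernel.comp measurable_prodMk_right)
    (hac.ae_le (hsplit.mono fun y hy => hac.ae_le hy))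
  have hac' := absolutelyContinuous_tilted M.integrable_exp_potential
  have hH' : ∀ᵐ z ∂(ν.prod ν), φ z.1 z.2 = H := (hac'.prod hac').ae_le hH
  rcases lt_or_gt_of_ne t.2 with h | h
  · exact M.not_ae_const hN hθ hmin h H hH'
  · exact M.not_ae_const hN hθ hmin h H hH'

end KernelModel

end Identifiability

theorem pi_const_zero {ι Ω : Type*} [Fintype ι] [Nonempty ι] [MeasurableSpace Ω] :
    Measure.pi (fun _ : ι => (0 : Measure Ω)) = 0 :=
  Measure.measure_univ_eq_zero.1 (by rw [Measure.pi_univ]; simp)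

/-! ### Probability of the good event -/

section Concentration

variable {𝒳 : Type*} [MeasurableSpace 𝒳] {ν : Measure 𝒳}
  {φ : 𝒳 → 𝒳 → ℝ} {f : 𝒳 → ℝ} {p : ℕ} {θ : Fin p → Fin p → ℝ} {s : Fin p}

theorem nodeGrad_apply {n : ℕ} (X : Fin n → Fin p → 𝒳) (θs : NodeParam s)
    (t : {t : Fin p // t ≠ s}) :
    nodeGrad ν f φ X θs t = -(1 / (n : ℝ) * ∑ i, centred ν f φ θs (X i) (X i s) t) := by
  simp [nodeGrad]

namespace KernelModel

variable [SigmaFinite ν] [NeZero ν]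

theorem measure_nodeGrad_le (M : KernelModel ν f φ) (hA : ∀ᶠ θ' in 𝓝 θ, Normalizable ν f φ θ')
    (hθ : ∀ s t, θ s t = θ t s) (s : Fin p) {n : ℕ} (hn : 0 < n) {a : ℝ} (ha : 0 < a) :
    (Measure.pi fun _ : Fin n => jointLaw ν f φ θ)
        {X | ∃ t, a ≤ |nodeGrad ν f φ X (nodeParam θ s) t|}
      ≤ ENNReal.ofReal ((∑ t, variance (fun x => centred ν f φ (nodeParam θ s) x (x s) t)
        (jointLaw ν f φ θ)) / (n * a ^ 2)) := by
  have := isProbabilityMeasure_jointLaw hA.self_of_nhds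
  have hset : {X : Fin n → Fin p → 𝒳 | ∃ t, a ≤ |nodeGrad ν f φ X (nodeParam θ s) t|}
      = ⋃ t, {X | a ≤ |nodeGrad ν f φ X (nodeParam θ s) t|} := by ext; simp
  rw [hset, Finset.sum_div, ENNReal.ofReal_sum_of_nonneg fun t _ => div_nonneg
    (variance_nonneg _ _) (by positivity)]
  refine (measure_iUnion_fintype_le _ _).trans (Finset.sum_le_sum fun t _ => ?_)
  have h := sampleMean_deviation (M.memLp_score hA hθ t) hn ha
  rw [M.integral_score hA hθ t] at h
  refine (measure_mono fun X hX => ?_).trans h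
  simpa [nodeGrad_apply] using hX

theorem measure_curvatureEntry_le (M : KernelModel ν f φ) (hN : Normalizable ν f φ θ)
    (θs : NodeParam s) {n : ℕ} (hn : 0 < n) {ε : ℝ} (hε : 0 < ε) :
    (Measure.pi fun _ : Fin n => jointLaw ν f φ θ)
        {X | ∃ t t', ε ≤ |1 / (n : ℝ) * ∑ i, curvatureEntry ν f φ θs t t' (X i)
          - ∫ x, curvatureEntry ν f φ θs t t' x ∂(jointLaw ν f φ θ)|}
      ≤ ENNReal.ofReal ((∑ t, ∑ t', variance (curvatureEntry ν f φ θs t t')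
        (jointLaw ν f φ θ)) / (n * ε ^ 2)) := by
  have := isProbabilityMeasure_jointLaw hN
  have hset : {X : Fin n → Fin p → 𝒳 | ∃ t t',
        ε ≤ |1 / (n : ℝ) * ∑ i, curvatureEntry ν f φ θs t t' (X i)
          - ∫ x, curvatureEntry ν f φ θs t t' x ∂(jointLaw ν f φ θ)|}
      = ⋃ t, ⋃ t', {X | ε ≤ |1 / (n : ℝ) * ∑ i, curvatureEntry ν f φ θs t t' (X i)
          - ∫ x, curvatureEntry ν f φ θs t t' x ∂(jointLaw ν f φ θ)|} := by ext; simp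
  have hnn : ∀ t t', 0 ≤ variance (curvatureEntry ν f φ θs t t') (jointLaw ν f φ θ) / (n * ε ^ 2) :=
    fun t t' => div_nonneg (variance_nonneg _ _) (by positivity)
  simp_rw [hset, Finset.sum_div]
  rw [ENNReal.ofReal_sum_of_nonneg fun t _ => Finset.sum_nonneg fun t' _ => hnn t t']
  refine (measure_iUnion_fintype_le _ _).trans (Finset.sum_le_sum fun t _ => ?_)
  rw [ENNReal.ofReal_sum_of_nonneg fun t' _ => hnn t t']
  refine (measure_iUnion_fintype_le _ _).trans (Finset.sum_le_sum fun t' _ => ?_)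
  exact sampleMean_deviation (M.memLp_curvatureEntry hN θs t t') hn hε

/-- Uniform lower bound of the empirical curvature when its entries are close to their means. -/
theorem mul_sq_norm_le_sampleMean_curvature (M : KernelModel ν f φ) (hN : Normalizable ν f φ θ)
    (θs : NodeParam s) {m ε : ℝ} (hε : 0 ≤ ε)
    (hm : ∀ Δ : NodeParam s, m * ‖Δ‖ ^ 2 ≤ ∫ x, curvature ν f φ θs x Δ ∂(jointLaw ν f φ θ))
    {n : ℕ} {X : Fin n → Fin p → 𝒳}
    (hX : ∀ t t', |1 / (n : ℝ) * ∑ i, curvatureEntry ν f φ θs t t' (X i)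
      - ∫ x, curvatureEntry ν f φ θs t t' x ∂(jointLaw ν f φ θ)| ≤ ε) (Δ : NodeParam s) :
    (m - ε * Fintype.card {t : Fin p // t ≠ s}) * ‖Δ‖ ^ 2
      ≤ 1 / (n : ℝ) * ∑ i, curvature ν f φ θs (X i) Δ := by
  simp_rw [(M.integral_curvature_eq_sum hN θs _).2] at hm
  refine (quadraticForm_perturb hm hε hX Δ).trans_eq ?_
  simp_rw [M.curvature_eq_sum]
  simp_rw [Finset.mul_sum]
  symm
  rw [Finset.sum_comm]
  refine Finset.sum_congr rfl fun t _ => ?_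
  rw [Finset.sum_comm]
  refine Finset.sum_congr rfl fun t' _ => Finset.sum_congr rfl fun i _ => ?_
  ring

theorem exists_error_bound (M : KernelModel ν f φ) (hA : ∀ᶠ θ' in 𝓝 θ, Normalizable ν f φ θ')
    (hθ : ∀ s t, θ s t = θ t s) (hmin : HasMinimalRepresentation ν f φ θ) (hp : 2 ≤ p)
    (s : Fin p) {δ : ℝ} (hδ : 0 < δ) :
    ∃ C : ℝ, 0 < C ∧ ∀ c₀ : ℝ, 2 ≤ c₀ → ∃ N : ℕ, ∀ n : ℕ, N ≤ n →
      (Measure.pi fun _ : Fin n => jointLaw ν f φ θ)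
        {X | ¬ ∀ lam : ℝ,
          2 * nodeGradSup ν f φ X (nodeParam θ s) ≤ lam →
          lam ≤ c₀ * nodeGradSup ν f φ X (nodeParam θ s) →
          (nodeEstimators ν f φ s X lam).Nonempty ∧
          ∀ θhat ∈ nodeEstimators ν f φ s X lam,
            ‖θhat - nodeParam θ s‖ ≤
              C * c₀ * √((l0Norm (nodeParam θ s) : ℝ) * Real.log p / n)}
      ≤ ENNReal.ofReal δ := by
  have hN := hA.self_of_nhds
  have hlog : 0 < Real.log p := Real.log_pos (by exact_mod_cast hp)
  obtain ⟨m, hm0, hm⟩ : ∃ m : ℝ, 0 < m ∧ ∀ Δ : NodeParam s, m * ‖Δ‖ ^ 2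
      ≤ ∫ x, curvature ν f φ (nodeParam θ s) x Δ ∂(jointLaw ν f φ θ) := by
    simp_rw [(M.integral_curvature_eq_sum hN (nodeParam θ s) _).2]
    refine exists_pos_mul_sq_norm_le fun Δ hΔ => ?_
    rw [← (M.integral_curvature_eq_sum hN (nodeParam θ s) _).2]
    exact M.integral_curvature_pos hN hθ hmin hΔ
  set V := ∑ t, variance (fun x => centred ν f φ (nodeParam θ s) x (x s) t) (jointLaw ν f φ θ)
  have hV : 0 ≤ V := Finset.sum_nonneg fun t _ => variance_nonneg _ _
  set W := ∑ t, ∑ t', variance (curvatureEntry ν f φ (nodeParam θ s) t t') (jointLaw ν f φ θ)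
  set d : ℝ := (Fintype.card {t : Fin p // t ≠ s} : ℝ)
  have hd : 0 ≤ d := Nat.cast_nonneg _
  -- Entrywise accuracy `ε` preserves half of the population curvature.
  set ε := m / (2 * (d + 1)) with hε
  have hε0 : 0 < ε := by positivity
  have hεd : m / 2 ≤ m - ε * d := by
    have : ε * d ≤ m / 2 := by
      rw [hε, div_mul_eq_mul_div, div_le_div_iff₀ (by positivity) two_pos]
      nlinarith
    linarith
  -- With `a = B √(log p / n)` this makes `n a² = 2 (V + 1) / δ`, so the gradient event fails with
  -- probability at most `δ / 2`; the `+ 1` keeps `B` positive.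
  set B := √(2 * (V + 1) / (δ * Real.log p)) with hB
  have hB0 : 0 < B := Real.sqrt_pos.2 (by positivity)
  set k : ℝ := (l0Norm (nodeParam θ s) : ℝ)
  -- The `12` of `nodeEstimators_error`, doubled because only curvature `m / 2` is available. `c₀`
  -- affects `N` through the smallness condition.
  refine ⟨24 * B / m, by positivity, fun c₀ hc₀ => ?_⟩
  have hinv : Tendsto (fun n : ℕ => ((n : ℝ))⁻¹) atTop (𝓝 0) := tendsto_inv_atTop_nhds_zero_nat
  have ev1 : ∀ᶠ n : ℕ in atTop, 12 * (c₀ * (B * √(Real.log p / n))) * √k < m / 2 := by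
    have h1 : Tendsto (fun n : ℕ => 12 * (c₀ * (B * √(Real.log p * ((n : ℝ))⁻¹))) * √k) atTop
        (𝓝 (12 * (c₀ * (B * √(Real.log p * 0))) * √k)) :=
      (((((hinv.const_mul _).sqrt).const_mul B).const_mul c₀).const_mul 12).mul_const _
    simp only [mul_zero, Real.sqrt_zero, zero_mul] at h1
    exact h1.eventually_lt_const (by positivity)
  have ev2 : ∀ᶠ n : ℕ in atTop, W / (n * ε ^ 2) < δ / 2 := by
    have h1 : Tendsto (fun n : ℕ => W / ε ^ 2 * ((n : ℝ))⁻¹) atTop (𝓝 (W / ε ^ 2 * 0)) :=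
      hinv.const_mul _
    rw [mul_zero] at h1
    refine (h1.eventually_lt_const (half_pos hδ)).mono fun n hn => ?_
    rwa [mul_comm (n : ℝ), ← div_div, div_eq_mul_inv (W / ε ^ 2)]
  obtain ⟨N, hN'⟩ := eventually_atTop.1 (ev1.and (ev2.and (eventually_gt_atTop 0)))
  refine ⟨N, fun n hn => ?_⟩
  obtain ⟨h1, h2, hn0⟩ := hN' n hn
  have hn0' : (0 : ℝ) < n := by exact_mod_cast hn0
  set a := B * √(Real.log p / n) with ha
  have ha0 : 0 < a := mul_pos hB0 (Real.sqrt_pos.2 (by positivity))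
  have hna : V / (n * a ^ 2) ≤ δ / 2 := by
    have : n * a ^ 2 = 2 * (V + 1) / δ := by
      rw [ha, mul_pow, hB, Real.sq_sqrt (by positivity), Real.sq_sqrt (by positivity)]
      field_simp
    rw [this, div_div_eq_mul_div, div_le_div_iff₀ (by positivity) two_pos]
    nlinarith
  have hP1 := M.measure_nodeGrad_le hA hθ s hn0 ha0
  have hP2 := M.measure_curvatureEntry_le hN (nodeParam θ s) hn0 hε0
  calc _ ≤ (Measure.pi fun _ : Fin n => jointLaw ν f φ θ)
        ({X | ∃ t, a ≤ |nodeGrad ν f φ X (nodeParam θ s) t|} ∪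
        {X | ∃ t t', ε ≤ |1 / (n : ℝ) * ∑ i, curvatureEntry ν f φ (nodeParam θ s) t t' (X i)
          - ∫ x, curvatureEntry ν f φ (nodeParam θ s) t t' x ∂(jointLaw ν f φ θ)|}) := by
        refine measure_mono fun X hX => ?_
        by_contra hX'
        simp only [Set.mem_union, Set.mem_ofPred_eq, not_or, not_exists, not_le] at hX'
        refine hX fun lam hl hu => ?_
        have hcurv := M.mul_sq_norm_le_sampleMean_curvature hN (nodeParam θ s) hε0.le hm
          (X := X) fun t t' => (hX'.2 t t').le
        obtain ⟨r1, r2⟩ := M.nodeEstimators_error X (nodeParam θ s) (m := m / 2) (a := a)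
          (c₀ := c₀) (by positivity) (fun Δ => le_trans (by gcongr) (hcurv Δ))
          (fun t => (hX'.1 t).le) ha0.le (by linarith) h1 hl hu
        refine ⟨r1, fun θhat hθhat => (r2 θhat hθhat).trans_eq ?_⟩
        rw [mul_div_assoc (k : ℝ), Real.sqrt_mul (Nat.cast_nonneg _), ha]
        field_simp
        ring
    _ ≤ _ := measure_union_le _ _
    _ ≤ ENNReal.ofReal (δ / 2) + ENNReal.ofReal (δ / 2) :=
        add_le_add (hP1.trans (ENNReal.ofReal_le_ofReal hna))
          (hP2.trans (ENNReal.ofReal_le_ofReal h2.le))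
    _ = ENNReal.ofReal δ := by
        rw [← ENNReal.ofReal_add (by positivity) (by positivity), add_halves]

end KernelModel

end Concentration

end SemiEFGM

/-! ### The error bound, including degenerate models -/

theorem corollary2 {𝒳 : Type*} [MeasurableSpace 𝒳] (ν : Measure 𝒳) [SigmaFinite ν]
    (φ : 𝒳 → 𝒳 → ℝ) (hφ_meas : Measurable (Function.uncurry φ))
    (hφ : SemiEFGM.IsMercerKernel φ)
    (hφ_int : ∀ c : ℝ, 0 < c → Integrable (fun x => Real.exp (-c * φ x x)) ν)
    (f : 𝒳 → ℝ) (hf : ∀ x, f x = -φ x x)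
    {p : ℕ} (θ : Fin p → Fin p → ℝ) (hθ_symm : ∀ s t, θ s t = θ t s)
    (hA : ∀ᶠ θ' in 𝓝 θ, SemiEFGM.Normalizable ν f φ θ')
    (hmin : SemiEFGM.HasMinimalRepresentation ν f φ θ)
    (hθ_small : ∀ s t, s ≠ t → |θ s t| < 0.25)
    (s : Fin p) (κ : ℝ) (hκ : 0 < κ) :
    ∃ C : ℝ, 0 < C ∧ ∀ c₀ : ℝ, 2 ≤ c₀ → ∃ N : ℕ, ∀ n : ℕ, N ≤ n →
      (Measure.pi fun _ : Fin n => SemiEFGM.jointLaw ν f φ θ)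
        {X | ¬ ∀ lam : ℝ,
          2 * SemiEFGM.nodeGradSup ν f φ X (SemiEFGM.nodeParam θ s) ≤ lam →
          lam ≤ c₀ * SemiEFGM.nodeGradSup ν f φ X (SemiEFGM.nodeParam θ s) →
          (SemiEFGM.nodeEstimators ν f φ s X lam).Nonempty ∧
          ∀ θhat ∈ SemiEFGM.nodeEstimators ν f φ s X lam,
            ‖θhat - SemiEFGM.nodeParam θ s‖ ≤
              C * c₀ * Real.sqrt
                ((SemiEFGM.l0Norm (SemiEFGM.nodeParam θ s) : ℝ) * Real.log p / n)}
      ≤ ENNReal.ofReal ((p : ℝ) ^ (-κ)) := by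

  have M : SemiEFGM.KernelModel ν f φ := ⟨hφ_meas, hφ, hφ_int, hf⟩
  rcases eq_or_ne ν 0 with rfl | hν
  -- For `ν = 0` the joint law is zero, and so is its `n`-fold product once `n ≥ 1`; the empty
  -- product is a unit mass, hence `N = 1`.
  · refine ⟨1, one_pos, fun c₀ _ => ⟨1, fun n hn => ?_⟩⟩
    have : Nonempty (Fin p) := ⟨s⟩
    have : Nonempty (Fin n) := ⟨⟨0, hn⟩⟩
    have hJ : SemiEFGM.jointLaw (0 : Measure 𝒳) f φ θ = 0 := by
      rw [SemiEFGM.jointLaw, SemiEFGM.pi_const_zero, withDensity_zero_left]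
    rw [hJ, SemiEFGM.pi_const_zero]
    exact zero_le
  · have : NeZero ν := ⟨hν⟩
    have := SemiEFGM.isProbabilityMeasure_jointLaw hA.self_of_nhds
    have hp0 : 0 < p := s.pos
    rcases (Nat.succ_le_of_lt hp0).eq_or_lt with hp | hp
    -- For `p = 1` the allowed failure probability is `1`; otherwise `log p > 0`.
    · refine ⟨1, one_pos, fun c₀ _ => ⟨0, fun n _ => prob_le_one.trans ?_⟩⟩
      simp [← hp]
    · exact M.exists_error_bound hA hθ_symm hmin hp s
        (Real.rpow_pos_of_pos (by exact_mod_cast hp0) _)
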